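/- Let $f:\mathbb{R}\to\mathbb{R}$ be smooth, and let $\mathcal{M}_f=(\mathbb{R}^3,g_f)$, where in coordinates $(x,y,\tilde x)$ the Lorentz metric $g_f$ has as its only nonzero components (up to symmetry) $$g_f(\partial_x,\partial_x)=-2f(y),\qquad g_f(\partial_x,\partial_{\tilde x})=g_f(\partial_y,\partial_y)=1 .$$ For $\varepsilon=\pm1$ let $\mathcal{S}_\varepsilon$ be $\mathcal{M}_f$ with $f(y)=\tfrac12\varepsilon y^2$. Let $\nabla$ be the Levi-Civita connection, $\mathcal{R}(X,Y)=\nabla_X\nabla_Y-\nabla_Y\nabla_X-\nabla_{[X,Y]}$ and $R(X,Y,Z,W)=g(\mathcal{R}(X,Y)Z,W)$. *Definitions.* A *scalar Weyl invariant* is a linear combination of complete contractions, with indices contracted in pairs by the metric, of products of one or more of the tensors $\nabla^kR$, $k\ge0$. A *local symmetric space* is one with $\nabla R=0$. *Indecomposable* means that (a) at no point $P$ is there an orthogonal direct sum decomposition $T_P=V\oplus W$ with $V,W\neq0$ and $R_P=R_V\oplus R_W$, and (b) no point has a neighborhood isometric to a product of two pseudo-Riemannian manifolds of positive dimension. $\mathcal{M}$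 is *$k$-curvature modeled on* $\mathcal{N}$ if for all points $P$ of $\mathcal{M}$ and $Q$ of $\mathcal{N}$ there is a linear isometry $\phi:T_P\mathcal{M}\to T_Q\mathcal{N}$ with $\phi^*\nabla^iR_Q=\nabla^iR_P$ for $0\le i\le k$; $\mathcal{M}$ is *$k$-curvature homogeneous* if it is $k$-curvature modeled on itself. $\mathcal{M}$ is *$k$-affine curvature homogeneous* if for all points $P,Q$ there is a linear isomorphism $\phi:T_P\to T_Q$ with $\phi^*\nabla^i\mathcal{R}_Q=\nabla^i\mathcal{R}_P$ for $0\le i\le k$. $\mathcal{M}$ is *locally homogeneous* if for all points $P,Q$ there is a smooth isometry from a neighborhood of $P$ onto a neighborhood of $Q$ that takes $P$ to $Q$. **Theorem 1.2.** 1. All scalar Weyl invariants of $\mathcal{M}_f$ vanish identically. 2. For $\varepsilon=\pm1$, $\mathcal{S}_\varepsilon$ is an indecomposable local symmetric space. 3. If $f''(y)\ne0$ for all $y\in\mathbb{R}$, then $f''$ has constant sign $\varepsilon=\operatorname{sign}(f'')\in\{1,-1\}$, and $\mathcal{M}_f$ is $0$-curvature modeled on $\mathcal{S}_\varepsilon$.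 4. Assume that $f''(y)\ne0$ and $f'''(y)\ne0$ for all $y\in\mathbb{R}$. Then: - (a) $\mathcal{M}_f$ is $1$-affine curvature homogeneous. - (b) $\mathcal{M}_f$ is $1$-curvature homogeneous if and only if there are $a,b\in\mathbb{R}$ with $f''(y)=ae^{by}$ for all $y$. - (c) The following are equivalent: (i) $\mathcal{M}_f$ is locally homogeneous; (ii) $\mathcal{M}_f$ is $k$-curvature homogeneous for all $k\ge0$; (iii) $\mathcal{M}_f$ is $2$-curvature homogeneous; (iv) $\mathcal{M}_f$ is $2$-affine curvature homogeneous; (v) there are $a,b\in\mathbb{R}$ with $f'(y)=ae^{by}$ for all $y$. -/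

import Mathlib

open scoped ContDiff

noncomputable section

/-! Pseudo-Riemannian geometry on (open subsets of) the coordinate space `ι → ℝ`.  All tangent
spaces are identified with `ι → ℝ` through the coordinate frame `∂_i = Pi.single i 1`. -/

/-- A field of bilinear forms: `g p i j = g_p(∂_i, ∂_j)`. -/
abbrev MetricField (ι : Type) : Type := (ι → ℝ) → Matrix ι ι ℝ

/-- A covariant tensor field of rank `r`, by components: `T p J = T_p(∂_{J 0}, …, ∂_{J (r-1)})`. -/
abbrev TensorField (ι : Type) (r : ℕ) : Type := (ι → ℝ) → (Fin r → ι) → ℝ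

/-- A vector-valued covariant tensor field of rank `r` (type `(1, r)`): `T p l J` is the
coefficient of `∂_l` in `T_p(∂_{J 0}, …, ∂_{J (r-1)})`. -/
abbrev VectorTensorField (ι : Type) (r : ℕ) : Type := (ι → ℝ) → ι → (Fin r → ι) → ℝ

/-- Connection coefficients: `Γ p l i j` is the coefficient of `∂_l` in `∇_{∂_i} ∂_j` at `p`. -/
abbrev ConnectionCoeffs (ι : Type) : Type := (ι → ℝ) → ι → ι → ι → ℝ

section Geometry

variable {ι κ : Type} [Fintype ι] [DecidableEq ι] [Fintype κ] [DecidableEq κ]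

/-- `g` is a smooth pseudo-Riemannian metric on the set `U` (of use for `U` open). -/
structure IsPseudoMetricOn (g : MetricField ι) (U : Set (ι → ℝ)) : Prop where
  smooth : ∀ i j, ContDiffOn ℝ ∞ (fun p => g p i j) U
  symm : ∀ p ∈ U, (g p).IsSymm
  nondegenerate : ∀ p ∈ U, (g p).det ≠ 0

/-- The scalar product `g_p(v, w)`. -/
def MetricField.inner (g : MetricField ι) (p v w : ι → ℝ) : ℝ :=
  ∑ i, ∑ j, g p i j * v i * w j

/-- The partial derivative `∂_i F` at `p`. -/
def partialDeriv (i : ι) (F : (ι → ℝ) → ℝ) (p : ι → ℝ) : ℝ :=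
  fderiv ℝ F p (Pi.single i 1)

/-- The value `T_p(v_0, …, v_{r-1})`. -/
def TensorField.eval {r : ℕ} (T : TensorField ι r) (p : ι → ℝ) (v : Fin r → ι → ℝ) : ℝ :=
  ∑ J : Fin r → ι, T p J * ∏ s, v s (J s)

/-- The vector `T_p(v_0, …, v_{r-1})`. -/
def VectorTensorField.eval {r : ℕ} (T : VectorTensorField ι r) (p : ι → ℝ)
    (v : Fin r → ι → ℝ) : ι → ℝ :=
  fun l => ∑ J : Fin r → ι, T p l J * ∏ s, v s (J s)

/-- The covariant derivative of a covariant tensor field; the direction of differentiation is the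
last argument. -/
def TensorField.covDeriv {r : ℕ} (Γ : ConnectionCoeffs ι) (T : TensorField ι r) :
    TensorField ι (r + 1) :=
  fun p J =>
    partialDeriv (J (Fin.last r)) (fun q => T q (Fin.init J)) p
      - ∑ s : Fin r, ∑ m, Γ p m (J (Fin.last r)) (Fin.init J s)
          * T p (Function.update (Fin.init J) s m)

/-- The covariant derivative of a vector-valued covariant tensor field; the direction of
differentiation is the last argument. -/
def VectorTensorField.covDeriv {r : ℕ} (Γ : ConnectionCoeffs ι) (T : VectorTensorField ι r) :
    VectorTensorField ι (r + 1) :=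
  fun p l J =>
    partialDeriv (J (Fin.last r)) (fun q => T q l (Fin.init J)) p
      + ∑ m, Γ p l (J (Fin.last r)) m * T p m (Fin.init J)
      - ∑ s : Fin r, ∑ m, Γ p m (J (Fin.last r)) (Fin.init J s)
          * T p l (Function.update (Fin.init J) s m)

/-- The iterated covariant derivative `∇^k T`. -/
def TensorField.iterCovDeriv {r : ℕ} (Γ : ConnectionCoeffs ι) (T : TensorField ι r) :
    (k : ℕ) → TensorField ι (r + k)
  | 0 => T
  | k + 1 => TensorField.covDeriv Γ (TensorField.iterCovDeriv Γ T k)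

/-- The iterated covariant derivative `∇^k T` of a vector-valued tensor field. -/
def VectorTensorField.iterCovDeriv {r : ℕ} (Γ : ConnectionCoeffs ι) (T : VectorTensorField ι r) :
    (k : ℕ) → VectorTensorField ι (r + k)
  | 0 => T
  | k + 1 => VectorTensorField.covDeriv Γ (VectorTensorField.iterCovDeriv Γ T k)

/-- The curvature operator `ℛ(X, Y)Z = ∇_X ∇_Y Z - ∇_Y ∇_X Z - ∇_{[X, Y]} Z` of a connection:
the component at `l, J` is the coefficient of `∂_l` in `ℛ(∂_{J 0}, ∂_{J 1}) ∂_{J 2}`. -/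
def curvatureOperator (Γ : ConnectionCoeffs ι) : VectorTensorField ι 3 :=
  fun p l J =>
    partialDeriv (J 0) (fun q => Γ q l (J 1) (J 2)) p
      - partialDeriv (J 1) (fun q => Γ q l (J 0) (J 2)) p
      + ∑ m, (Γ p l (J 0) m * Γ p m (J 1) (J 2) - Γ p l (J 1) m * Γ p m (J 0) (J 2))

/-- The Christoffel symbols of the second kind, i.e. the Levi-Civita connection of `g`. -/
def MetricField.leviCivita (g : MetricField ι) : ConnectionCoeffs ι :=
  fun p l i j => (1 / 2) * ∑ m, (g p)⁻¹ l m *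
    (partialDeriv i (fun q => g q m j) p + partialDeriv j (fun q => g q i m) p
      - partialDeriv m (fun q => g q i j) p)

/-- The curvature tensor `R(X, Y, Z, W) = g(ℛ(X, Y)Z, W)` of the Levi-Civita connection. -/
def MetricField.riemann (g : MetricField ι) : TensorField ι 4 :=
  fun p J => ∑ l, curvatureOperator g.leviCivita p l ![J 0, J 1, J 2] * g p l (J 3)

/-- `∇^k R`, with the arguments in the order `∇^k R(ξ_1, ξ_2, ξ_3, ξ_4; ξ_5, …, ξ_{4+k})`. -/
def MetricField.nablaRiemann (g : MetricField ι) (k : ℕ) : TensorField ι (4 + k) :=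
  TensorField.iterCovDeriv g.leviCivita g.riemann k

/-- `∇^k ℛ` for a connection. -/
def nablaCurvatureOperator (Γ : ConnectionCoeffs ι) (k : ℕ) : VectorTensorField ι (3 + k) :=
  VectorTensorField.iterCovDeriv Γ (curvatureOperator Γ) k

/-- The complete contraction of `∇^{k 0} R ⊗ … ⊗ ∇^{k m} R` (at least one factor), in which the
indices are contracted in pairs by the inverse metric; the bijection `e` lists the pairs. -/
def MetricField.completeContraction (g : MetricField ι) (m : ℕ) (k : Fin (m + 1) → ℕ) (N : ℕ)
    (e : Fin N × Fin 2 ≃ (Σ s : Fin (m + 1), Fin (4 + k s))) (p : ι → ℝ) : ℝ :=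
  ∑ J : (Σ s : Fin (m + 1), Fin (4 + k s)) → ι,
    (∏ t : Fin N, (g p)⁻¹ (J (e (t, 0))) (J (e (t, 1))))
      * ∏ s : Fin (m + 1), g.nablaRiemann (k s) p (fun a => J ⟨s, a⟩)

/-- The scalar Weyl invariants (without constant term) of `g`, as functions: all linear
combinations of complete contractions. -/
def MetricField.weylInvariants (g : MetricField ι) : Submodule ℝ ((ι → ℝ) → ℝ) :=
  Submodule.span ℝ {W | ∃ (m : ℕ) (k : Fin (m + 1) → ℕ) (N : ℕ)
    (e : Fin N × Fin 2 ≃ (Σ s : Fin (m + 1), Fin (4 + k s))), W = g.completeContraction m k N e}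

/-- Isomorphism of the `k`-curvature models of `g` at `P` and of `h` at `Q`: a linear isometry of
the tangent spaces which pulls `∇^i R` of `h` back to that of `g` for `0 ≤ i ≤ k`. -/
def CurvatureModelIso (k : ℕ) (g h : MetricField ι) (P Q : ι → ℝ) : Prop :=
  ∃ φ : (ι → ℝ) ≃ₗ[ℝ] (ι → ℝ),
    (∀ v w, h.inner Q (φ v) (φ w) = g.inner P v w) ∧
    ∀ i ≤ k, ∀ v : Fin (4 + i) → ι → ℝ,
      (h.nablaRiemann i).eval Q (fun s => φ (v s)) = (g.nablaRiemann i).eval P v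

/-- `g` is `k`-curvature modeled on `h` (both on the whole coordinate space). -/
def CurvatureModeledOn (k : ℕ) (g h : MetricField ι) : Prop :=
  ∀ P Q, CurvatureModelIso k g h P Q

/-- `k`-curvature homogeneity of a metric on the whole coordinate space. -/
def CurvatureHomogeneous (k : ℕ) (g : MetricField ι) : Prop :=
  ∀ P Q, CurvatureModelIso k g g P Q

/-- `k`-affine curvature homogeneity of a connection on the whole coordinate space: the tangent
spaces at any two points are linearly isomorphic so that `∇^i ℛ` corresponds for `0 ≤ i ≤ k`. -/
def AffineCurvatureHomogeneous (k : ℕ) (Γ : ConnectionCoeffs ι) : Prop :=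
  ∀ P Q, ∃ φ : (ι → ℝ) ≃ₗ[ℝ] (ι → ℝ),
    ∀ i ≤ k, ∀ v : Fin (3 + i) → ι → ℝ,
      (nablaCurvatureOperator Γ i).eval Q (fun s => φ (v s))
        = φ ((nablaCurvatureOperator Γ i).eval P v)

/-- `Φ` is a smooth isometry from its (open) source, with the metric `g`, onto its (open) target,
with the metric `h`. -/
structure IsLocalIsometry (g : MetricField ι) (h : MetricField κ)
    (Φ : OpenPartialHomeomorph (ι → ℝ) (κ → ℝ)) : Prop where
  smooth : ContDiffOn ℝ ∞ Φ Φ.source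
  smooth_symm : ContDiffOn ℝ ∞ Φ.symm Φ.target
  isometry : ∀ p ∈ Φ.source, ∀ v w,
    h.inner (Φ p) (fderiv ℝ Φ p v) (fderiv ℝ Φ p w) = g.inner p v w

/-- Local homogeneity of a metric on the whole coordinate space. -/
def LocallyHomogeneous (g : MetricField ι) : Prop :=
  ∀ P Q, ∃ Φ : OpenPartialHomeomorph (ι → ℝ) (ι → ℝ),
    IsLocalIsometry g g Φ ∧ P ∈ Φ.source ∧ Φ P = Q

/-- A local symmetric space: `∇R = 0`. -/
def LocallySymmetric (g : MetricField ι) : Prop :=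
  ∀ p J, g.nablaRiemann 1 p J = 0

/-- The triple `(T_P, g_P, R_P)` is indecomposable: it has no orthogonal direct sum decomposition
`T_P = V ⊕ W`, `R_P = R_V ⊕ R_W` with both summands nontrivial. -/
def CurvatureModelIndecomposable (g : MetricField ι) (P : ι → ℝ) : Prop :=
  ∀ V W : Submodule ℝ (ι → ℝ), IsCompl V W →
    (∀ v ∈ V, ∀ w ∈ W, g.inner P v w = 0) →
    (∀ u : Fin 4 → ι → ℝ, (∀ s, u s ∈ V ∨ u s ∈ W) → (∃ s, u s ∈ V) → (∃ s, u s ∈ W) →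
      g.riemann.eval P u = 0) →
    V = ⊥ ∨ W = ⊥

/-- The product metric `g₁ ⊕ g₂`. -/
def MetricField.prod (g₁ : MetricField ι) (g₂ : MetricField κ) : MetricField (ι ⊕ κ) :=
  fun p => Matrix.fromBlocks (g₁ fun i => p (Sum.inl i)) 0 0 (g₂ fun j => p (Sum.inr j))

/-- Some neighborhood of `P` is isometric to a product of two pseudo-Riemannian manifolds of
positive dimension (small, hence given on open subsets `U₁`, `U₂` of coordinate spaces). -/
def LocallyDecomposableAt (g : MetricField ι) (P : ι → ℝ) : Prop :=
  ∃ (m n : ℕ) (U₁ : Set (Fin (m + 1) → ℝ)) (U₂ : Set (Fin (n + 1) → ℝ))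
    (g₁ : MetricField (Fin (m + 1))) (g₂ : MetricField (Fin (n + 1)))
    (Φ : OpenPartialHomeomorph (ι → ℝ) (Fin (m + 1) ⊕ Fin (n + 1) → ℝ)),
    IsOpen U₁ ∧ IsOpen U₂ ∧ IsPseudoMetricOn g₁ U₁ ∧ IsPseudoMetricOn g₂ U₂ ∧
    Φ.target = {q | (fun i => q (Sum.inl i)) ∈ U₁ ∧ (fun j => q (Sum.inr j)) ∈ U₂} ∧
    IsLocalIsometry g (g₁.prod g₂) Φ ∧ P ∈ Φ.source

end Geometry

/-- The metric of `M_f` on `ℝ³`.  The coordinates with index `0, 1, 2` are `x, y, x̃`; the nonzero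
components are `g(∂_x, ∂_x) = -2 f(y)` and `g(∂_x, ∂_x̃) = g(∂_y, ∂_y) = 1`. -/
def metricM (f : ℝ → ℝ) : MetricField (Fin 3) :=
  fun p => !![-2 * f (p 1), 0, 1; 0, 1, 0; 1, 0, 0]

/-- The metric of `S_ε = M_f` with `f(y) = ε y² / 2`. -/
def metricS (ε : ℝ) : MetricField (Fin 3) :=
  metricM fun y => (1 / 2) * ε * y ^ 2

/-- For smooth `f` the field `metricM f` is indeed a pseudo-Riemannian metric on `ℝ³`. -/
theorem metricM_isPseudoMetricOn {f : ℝ → ℝ} (hf : ContDiff ℝ ∞ f) :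
    IsPseudoMetricOn (metricM f) Set.univ where
  smooth i j := by
    have h : ContDiff ℝ ∞ fun p : Fin 3 → ℝ => f (p 1) := hf.comp (contDiff_apply ℝ ℝ 1)
    apply ContDiff.contDiffOn
    fin_cases i <;> fin_cases j <;> simp [metricM] <;> fun_prop
  symm p _ := by
    ext i j
    fin_cases i <;> fin_cases j <;> simp [metricM]
  nondegenerate p _ := by
    simp [metricM, Matrix.det_fin_three]

end

open scoped Topology

noncomputable section

/-! ### Metric and connection as bilinear maps: smoothness and the Koszul formula. -/

section Calculus

variable {ι κ : Type} [Fintype ι] [DecidableEq ι] [Fintype κ] [DecidableEq κ]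

/-! Everything rests on a normal form. The only nonzero covariant derivatives of coordinate fields
are ∇_∂x ∂x = f' ∂y and ∇_∂x ∂y = ∇_∂y ∂x = -f' ∂x̃. Hence ω = dx ∧ dy and the endomorphism E (∂x ↦
-∂y, ∂y ↦ ∂x̃, ∂x̃ ↦ 0) are parallel, while ∇dy = -f' dx ⊗ dx. It follows that ℛ = f'' ω ⊗ E, R =
-f'' ω ⊗ ω, ∇R = -f''' ω ⊗ ω ⊗ dy and ∇²R = -ω ⊗ ω ⊗ (f'''' dy ⊗ dy - f' f''' dx ⊗ dx)
(`nablaRiemann_two_metricM`).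

Weyl invariants vanish because no component of ∇^k R involves x̃ and each nonzero one involves x,
whereas the inverse metric pairs x only with x̃. If f'' ≠ 0, an orthogonal splitting of the
curvature forces one summand into ker ω, where orthogonality kills it; a local product would induce
such a splitting.

An isometry matching R sends ∂y to a vector with y-component ±1, and rescales f'' and f''' by the
same square up to sign. So (f'''/f'')² is an invariant at order one, and its constancy suffices.
Affine isomorphisms may rescale y freely, which removes this obstruction. At order two f'
f'''/(f'')² is invariant in both settings. If it is constant, f'/f'' is a polynomial of degree at
most one in y without zeros, so it is constant and f' is exponential
(`exists_exp_of_mul_deriv_deriv`). Conversely, for exponential f' a translation in y combined with a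
rescaling of x and x̃ and a shear is an isometry.

Local homogeneity implies curvature homogeneity of every order by naturality: Koszul's formula gives
the transformation law of the connection, and induction on k gives that of ∇^k R
(`IsLocalIsometry.eval_nablaRiemann`). -/

/-- The symmetric bilinear form `g_p` as a continuous bilinear map. -/
def MetricField.form (g : MetricField ι) (p : ι → ℝ) : (ι → ℝ) →L[ℝ] (ι → ℝ) →L[ℝ] ℝ :=
  ∑ i, ∑ j, g p i j • (ContinuousLinearMap.proj (R := ℝ) (φ := fun _ : ι => ℝ) i).smulRight
    (ContinuousLinearMap.proj (R := ℝ) (φ := fun _ : ι => ℝ) j)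

/-- The bilinear map `(v, w) ↦ ∑ i j, v i * w j • ∇_{∂_i} ∂_j` at `p`. -/
def ConnectionCoeffs.bilin (Γ : ConnectionCoeffs ι) (p : ι → ℝ) :
    (ι → ℝ) →L[ℝ] (ι → ℝ) →L[ℝ] (ι → ℝ) :=
  ∑ l, ∑ i, ∑ j, Γ p l i j • (ContinuousLinearMap.proj (R := ℝ) (φ := fun _ : ι => ℝ) i).smulRight
    ((ContinuousLinearMap.proj (R := ℝ) (φ := fun _ : ι => ℝ) j).smulRight (Pi.single l (1 : ℝ)))

omit [DecidableEq ι] in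
theorem MetricField.form_apply (g : MetricField ι) (p v w : ι → ℝ) :
    g.form p v w = g.inner p v w := by
  simp [MetricField.form, MetricField.inner, mul_assoc]

theorem ConnectionCoeffs.bilin_apply (Γ : ConnectionCoeffs ι) (p v w : ι → ℝ) (l : ι) :
    Γ.bilin p v w l = ∑ i, ∑ j, Γ p l i j * v i * w j := by
  simp [ConnectionCoeffs.bilin, Pi.single_apply,
    Finset.sum_apply, mul_assoc]

theorem sum_mul_partialDeriv (F : (ι → ℝ) → ℝ) (p v : ι → ℝ) :
    ∑ i, v i * partialDeriv i F p = fderiv ℝ F p v := by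
  conv_rhs => rw [← Finset.univ_sum_single v, map_sum]
  refine Finset.sum_congr rfl fun i _ => ?_
  have : (Pi.single i (v i) : ι → ℝ) = v i • Pi.single i (1 : ℝ) := by
    rw [← Pi.single_smul]; simp
  rw [this, map_smul, smul_eq_mul, partialDeriv]

theorem ContDiffOn.partialDeriv {F : (ι → ℝ) → ℝ} {U : Set (ι → ℝ)} (hU : IsOpen U)
    (hF : ContDiffOn ℝ ∞ F U) (i : ι) : ContDiffOn ℝ ∞ (partialDeriv i F) U := by
  have h : ContDiffOn ℝ ∞ (fderiv ℝ F) U := hF.fderiv_of_isOpen hU (by simp)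
  exact h.clm_apply contDiffOn_const

theorem ContDiffOn.smul_constant {E F : Type*} [NormedAddCommGroup E] [NormedSpace ℝ E]
    [NormedAddCommGroup F] [NormedSpace ℝ F] {U : Set E} {a : E → ℝ} (ha : ContDiffOn ℝ ∞ a U)
    (c : F) : ContDiffOn ℝ ∞ (fun p => a p • c) U :=
  ha.smul contDiffOn_const

theorem MetricField.contDiffOn_form {g : MetricField ι} {U : Set (ι → ℝ)}
    (hg : IsPseudoMetricOn g U) : ContDiffOn ℝ ∞ g.form U := by
  unfold MetricField.form
  exact ContDiffOn.sum fun i _ => ContDiffOn.sum fun j _ => (hg.smooth i j).smul_constant _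

theorem ConnectionCoeffs.contDiffOn_bilin {Γ : ConnectionCoeffs ι} {U : Set (ι → ℝ)}
    (hΓ : ∀ l i j, ContDiffOn ℝ ∞ (fun p => Γ p l i j) U) : ContDiffOn ℝ ∞ Γ.bilin U := by
  unfold ConnectionCoeffs.bilin
  exact ContDiffOn.sum fun l _ => ContDiffOn.sum fun i _ => ContDiffOn.sum fun j _ =>
    (hΓ l i j).smul_constant _

theorem contDiffOn_det {E : Type*} [NormedAddCommGroup E] [NormedSpace ℝ E] {U : Set E}
    {M : E → Matrix ι ι ℝ} (hM : ∀ i j, ContDiffOn ℝ ∞ (fun p => M p i j) U) :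
    ContDiffOn ℝ ∞ (fun p => (M p).det) U := by
  simp only [Matrix.det_apply]
  exact ContDiffOn.sum fun σ _ => (contDiffOn_prod fun i _ => hM _ _).const_smul _

/-- Cramer's rule: each entry is a determinant in the given entries, divided by the nonvanishing
determinant of the matrix. -/
theorem contDiffOn_matrix_inv {E : Type*} [NormedAddCommGroup E] [NormedSpace ℝ E] {U : Set E}
    {M : E → Matrix ι ι ℝ} (hM : ∀ i j, ContDiffOn ℝ ∞ (fun p => M p i j) U)
    (hdet : ∀ p ∈ U, (M p).det ≠ 0) (i j : ι) : ContDiffOn ℝ ∞ (fun p => (M p)⁻¹ i j) U := by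
  simp only [Matrix.inv_def, Matrix.smul_apply, Matrix.adjugate_apply, Ring.inverse_eq_inv',
    smul_eq_mul]
  refine ((contDiffOn_det hM).inv hdet).mul (contDiffOn_det fun a b => ?_)
  rcases eq_or_ne a j with rfl | h
  · simpa using contDiffOn_const
  · simpa [Matrix.updateRow_apply, h] using hM a b

theorem MetricField.contDiffOn_leviCivita {g : MetricField ι} {U : Set (ι → ℝ)} (hU : IsOpen U)
    (hg : IsPseudoMetricOn g U) (l i j : ι) :
    ContDiffOn ℝ ∞ (fun p => g.leviCivita p l i j) U := by
  unfold MetricField.leviCivita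
  refine contDiffOn_const.mul (ContDiffOn.sum fun m _ => ?_)
  exact (contDiffOn_matrix_inv hg.smooth hg.nondegenerate l m).mul
    ((((hg.smooth m j).partialDeriv hU i).add ((hg.smooth i m).partialDeriv hU j)).sub
      ((hg.smooth i j).partialDeriv hU m))

theorem contDiffOn_curvatureOperator {Γ : ConnectionCoeffs ι} {U : Set (ι → ℝ)} (hU : IsOpen U)
    (hΓ : ∀ l i j, ContDiffOn ℝ ∞ (fun p => Γ p l i j) U) (l : ι) (J : Fin 3 → ι) :
    ContDiffOn ℝ ∞ (fun p => curvatureOperator Γ p l J) U := by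
  unfold curvatureOperator
  exact (((hΓ _ _ _).partialDeriv hU _).sub ((hΓ _ _ _).partialDeriv hU _)).add
    (ContDiffOn.sum fun m _ => ((hΓ _ _ _).mul (hΓ _ _ _)).sub ((hΓ _ _ _).mul (hΓ _ _ _)))

theorem MetricField.contDiffOn_riemann {g : MetricField ι} {U : Set (ι → ℝ)} (hU : IsOpen U)
    (hg : IsPseudoMetricOn g U) (J : Fin 4 → ι) :
    ContDiffOn ℝ ∞ (fun p => g.riemann p J) U := by
  unfold MetricField.riemann
  exact ContDiffOn.sum fun l _ =>
    (contDiffOn_curvatureOperator hU (g.contDiffOn_leviCivita hU hg) l _).mul (hg.smooth _ _)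

theorem TensorField.contDiffOn_covDeriv {Γ : ConnectionCoeffs ι} {U : Set (ι → ℝ)} (hU : IsOpen U)
    (hΓ : ∀ l i j, ContDiffOn ℝ ∞ (fun p => Γ p l i j) U) {r : ℕ} {T : TensorField ι r}
    (hT : ∀ J, ContDiffOn ℝ ∞ (fun p => T p J) U) (J : Fin (r + 1) → ι) :
    ContDiffOn ℝ ∞ (fun p => T.covDeriv Γ p J) U := by
  unfold TensorField.covDeriv
  exact ((hT _).partialDeriv hU _).sub
    (ContDiffOn.sum fun s _ => ContDiffOn.sum fun m _ => (hΓ _ _ _).mul (hT _))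

theorem MetricField.contDiffOn_nablaRiemann {g : MetricField ι} {U : Set (ι → ℝ)} (hU : IsOpen U)
    (hg : IsPseudoMetricOn g U) (k : ℕ) (J : Fin (4 + k) → ι) :
    ContDiffOn ℝ ∞ (fun p => g.nablaRiemann k p J) U := by
  induction k with
  | zero => exact g.contDiffOn_riemann hU hg J
  | succ k ih => exact TensorField.contDiffOn_covDeriv hU (g.contDiffOn_leviCivita hU hg) ih J

omit [DecidableEq ι] in
theorem MetricField.inner_comm {g : MetricField ι} {p : ι → ℝ} (hg : (g p).IsSymm)
    (v w : ι → ℝ) : g.inner p v w = g.inner p w v := by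
  unfold MetricField.inner
  rw [Finset.sum_comm]
  refine Finset.sum_congr rfl fun i _ => Finset.sum_congr rfl fun j _ => ?_
  rw [hg.apply]; ring

theorem MetricField.eq_zero_of_inner {g : MetricField ι} {p : ι → ℝ} (hg : (g p).det ≠ 0)
    {v : ι → ℝ} (h : ∀ w, g.inner p v w = 0) : v = 0 := by
  refine Matrix.eq_zero_of_vecMul_eq_zero hg ?_
  ext j
  have := h (Pi.single j 1)
  simpa [MetricField.inner, Matrix.vecMul, dotProduct, Pi.single_apply, mul_comm] using this

/-- The directional derivative of the metric, in components. -/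
theorem MetricField.fderiv_form_apply {g : MetricField ι} {U : Set (ι → ℝ)} {p : ι → ℝ}
    (hg : IsPseudoMetricOn g U) (hU : U ∈ 𝓝 p) (v u w : ι → ℝ) :
    fderiv ℝ g.form p v u w =
      ∑ i, ∑ j, (∑ k, v k * partialDeriv k (fun q => g q i j) p) * u i * w j := by
  have h : DifferentiableAt ℝ g.form p :=
    ((MetricField.contDiffOn_form hg).contDiffAt hU).differentiableAt (by simp)
  have hg : ∀ i j, DifferentiableAt ℝ (fun q => g q i j) p := fun i j =>
    ((hg.smooth i j).contDiffAt hU).differentiableAt (by simp)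
  have h1 : fderiv ℝ (fun q => g.form q u w) p v = fderiv ℝ g.form p v u w := by
    have := (h.hasFDerivAt.clm_apply (hasFDerivAt_const u p)).clm_apply (hasFDerivAt_const w p)
    rw [this.fderiv]
    simp
  have h2 : HasFDerivAt (fun q => g.form q u w)
      (∑ i, ∑ j, (u i * w j) • fderiv ℝ (fun q => g q i j) p) p := by
    simp only [MetricField.form_apply, MetricField.inner, mul_assoc]
    exact HasFDerivAt.fun_sum fun i _ => HasFDerivAt.fun_sum fun j _ =>
      (hg i j).hasFDerivAt.mul_const _
  rw [← h1, h2.fderiv]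
  simp only [sum_apply, smul_apply, sum_mul_partialDeriv, smul_eq_mul]
  exact Finset.sum_congr rfl fun i _ => Finset.sum_congr rfl fun j _ => by ring

/-- Lowering the upper index cancels the inverse metric in the Christoffel symbols. What remains is
Koszul's formula for coordinate fields, whose brackets vanish. -/
theorem MetricField.sum_mul_leviCivita {g : MetricField ι} {p : ι → ℝ} (hs : (g p).IsSymm)
    (hd : (g p).det ≠ 0) (a i j : ι) :
    ∑ l, g p l a * g.leviCivita p l i j = (1 / 2) *
      (partialDeriv i (fun q => g q a j) p + partialDeriv j (fun q => g q i a) p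
        - partialDeriv a (fun q => g q i j) p) := by
  simp only [MetricField.leviCivita, Finset.mul_sum]
  rw [Finset.sum_comm]
  have hinv : ∀ m, ∑ l, g p l a * (g p)⁻¹ l m = if a = m then 1 else 0 := by
    intro m
    have := congrFun (congrFun (Matrix.mul_nonsing_inv (g p) (Ne.isUnit hd)) a) m
    rw [Matrix.mul_apply, Matrix.one_apply] at this
    rw [← this]
    exact Finset.sum_congr rfl fun l _ => by rw [hs.apply]
  have : ∀ m, ∑ l, g p l a * (1 / 2 * ((g p)⁻¹ l m *
      (partialDeriv i (fun q => g q m j) p + partialDeriv j (fun q => g q i m) p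
        - partialDeriv m (fun q => g q i j) p))) =
      (∑ l, g p l a * (g p)⁻¹ l m) * (1 / 2 *
      (partialDeriv i (fun q => g q m j) p + partialDeriv j (fun q => g q i m) p
        - partialDeriv m (fun q => g q i j) p)) := by
    intro m
    rw [Finset.sum_mul]
    exact Finset.sum_congr rfl fun l _ => by ring
  rw [Finset.sum_congr rfl fun m _ => this m]
  simp [hinv]

/-- The Koszul formula. -/
theorem MetricField.inner_leviCivita {g : MetricField ι} {U : Set (ι → ℝ)} {p : ι → ℝ}
    (hg : IsPseudoMetricOn g U) (hU : U ∈ 𝓝 p) (v w u : ι → ℝ) :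
    g.form p (g.leviCivita.bilin p v w) u = (1 / 2) * (fderiv ℝ g.form p v u w
      + fderiv ℝ g.form p w v u - fderiv ℝ g.form p u v w) := by
  have key : g.form p (g.leviCivita.bilin p v w) u =
      ∑ a, ∑ i, ∑ j, (∑ l, g p l a * g.leviCivita p l i j) * (v i * w j * u a) := by
    rw [MetricField.form_apply]
    simp only [MetricField.inner, ConnectionCoeffs.bilin_apply, Finset.sum_mul, Finset.mul_sum]
    rw [Finset.sum_comm]
    refine Finset.sum_congr rfl fun a _ => ?_
    rw [Finset.sum_comm]
    refine Finset.sum_congr rfl fun i _ => ?_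
    rw [Finset.sum_comm]
    refine Finset.sum_congr rfl fun j _ => Finset.sum_congr rfl fun l _ => by ring
  have h1 : fderiv ℝ g.form p v u w = ∑ a, ∑ i, ∑ j,
      partialDeriv i (fun q => g q a j) p * (v i * w j * u a) := by
    rw [MetricField.fderiv_form_apply hg hU]
    simp only [Finset.sum_mul]
    refine Finset.sum_congr rfl fun a _ => ?_
    rw [Finset.sum_comm]
    exact Finset.sum_congr rfl fun i _ => Finset.sum_congr rfl fun j _ => by ring
  have h2 : fderiv ℝ g.form p w v u = ∑ a, ∑ i, ∑ j,
      partialDeriv j (fun q => g q i a) p * (v i * w j * u a) := by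
    rw [MetricField.fderiv_form_apply hg hU]
    simp only [Finset.sum_mul]
    rw [Finset.sum_comm]
    exact Finset.sum_congr rfl fun i _ => Finset.sum_congr rfl fun j _ =>
      Finset.sum_congr rfl fun j _ => by ring
  have h3 : fderiv ℝ g.form p u v w = ∑ a, ∑ i, ∑ j,
      partialDeriv a (fun q => g q i j) p * (v i * w j * u a) := by
    rw [MetricField.fderiv_form_apply hg hU]
    simp only [Finset.sum_mul]
    conv_lhs => enter [2, i]; rw [Finset.sum_comm]
    rw [Finset.sum_comm]
    exact Finset.sum_congr rfl fun i _ => Finset.sum_congr rfl fun j _ =>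
      Finset.sum_congr rfl fun j _ => by ring
  rw [key, h1, h2, h3, ← Finset.sum_add_distrib, ← Finset.sum_sub_distrib, Finset.mul_sum]
  refine Finset.sum_congr rfl fun a _ => ?_
  rw [← Finset.sum_add_distrib, ← Finset.sum_sub_distrib, Finset.mul_sum]
  refine Finset.sum_congr rfl fun i _ => ?_
  rw [← Finset.sum_add_distrib, ← Finset.sum_sub_distrib, Finset.mul_sum]
  refine Finset.sum_congr rfl fun j _ => ?_
  rw [MetricField.sum_mul_leviCivita (hg.symm p (mem_of_mem_nhds hU))
    (hg.nondegenerate p (mem_of_mem_nhds hU))]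
  ring

end Calculus

/-! ### Derivatives of pulled-back forms and curvature under smooth maps. -/

section Naturality

variable {E F : Type*} [NormedAddCommGroup E] [NormedSpace ℝ E]
  [NormedAddCommGroup F] [NormedSpace ℝ F]

theorem two_le_infty : (2 : ℕ∞ω) ≤ ∞ := by
  exact WithTop.coe_le_coe.2 (le_top : (2 : ℕ∞) ≤ ⊤)

theorem ContDiffAt.hasFDerivAt_fderiv {Φ : E → F} {p : E} (hΦ : ContDiffAt ℝ ∞ Φ p) :
    HasFDerivAt (fderiv ℝ Φ) (fderiv ℝ (fderiv ℝ Φ) p) p :=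
  ((hΦ.fderiv_right (m := ∞) (by simp)).differentiableAt (by simp)).hasFDerivAt

/-- The derivative of a pulled back field of bilinear forms. -/
theorem fderiv_pullback_form {G : E → E →L[ℝ] E →L[ℝ] ℝ} {H : F → F →L[ℝ] F →L[ℝ] ℝ} {Φ : E → F}
    {p : E} (hG : DifferentiableAt ℝ G p) (hH : DifferentiableAt ℝ H (Φ p))
    (hΦ : ContDiffAt ℝ ∞ Φ p)
    (hGH : ∀ᶠ q in 𝓝 p, ∀ u w, G q u w = H (Φ q) (fderiv ℝ Φ q u) (fderiv ℝ Φ q w))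
    (v u w : E) :
    fderiv ℝ G p v u w =
      fderiv ℝ H (Φ p) (fderiv ℝ Φ p v) (fderiv ℝ Φ p u) (fderiv ℝ Φ p w)
      + H (Φ p) (fderiv ℝ (fderiv ℝ Φ) p v u) (fderiv ℝ Φ p w)
      + H (Φ p) (fderiv ℝ Φ p u) (fderiv ℝ (fderiv ℝ Φ) p v w) := by
  have h1 := (hG.hasFDerivAt.clm_apply (hasFDerivAt_const u p)).clm_apply (hasFDerivAt_const w p)
  have hd : HasFDerivAt Φ (fderiv ℝ Φ p) p := (hΦ.differentiableAt (by simp)).hasFDerivAt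
  have hA := hΦ.hasFDerivAt_fderiv
  have hHΦ : HasFDerivAt (fun q => H (Φ q)) ((fderiv ℝ H (Φ p)).comp (fderiv ℝ Φ p)) p :=
    HasFDerivAt.comp (g := H) p hH.hasFDerivAt hd
  have h2 := (hHΦ.clm_apply
    (hA.clm_apply (hasFDerivAt_const u p))).clm_apply (hA.clm_apply (hasFDerivAt_const w p))
  have h3 := h1.congr_of_eventuallyEq (f₁ := fun q => H (Φ q) (fderiv ℝ Φ q u) (fderiv ℝ Φ q w))
    (by filter_upwards [hGH] with q hq using (hq u w).symm)
  have h4 := congrArg (fun L => L v) (h3.unique h2)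
  simp at h4
  linarith

/-- The curvature of a connection on a vector space with Christoffel field `γ`. -/
def christoffelCurvature (γ : E → E →L[ℝ] E →L[ℝ] E) (p u v w : E) : E :=
  fderiv ℝ γ p u v w - fderiv ℝ γ p v u w + (γ p u (γ p v w) - γ p v (γ p u w))

/-- Naturality of the curvature under an affine map of connections. -/
theorem christoffelCurvature_map {γ : E → E →L[ℝ] E →L[ℝ] E} {γ' : F → F →L[ℝ] F →L[ℝ] F}
    {Φ : E → F} {p : E} (hγ : DifferentiableAt ℝ γ p) (hγ' : DifferentiableAt ℝ γ' (Φ p))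
    (hΦ : ContDiffAt ℝ ∞ Φ p)
    (h : ∀ᶠ q in 𝓝 p, ∀ v w, fderiv ℝ Φ q (γ q v w) =
      γ' (Φ q) (fderiv ℝ Φ q v) (fderiv ℝ Φ q w) + fderiv ℝ (fderiv ℝ Φ) q v w) (u v w : E) :
    fderiv ℝ Φ p (christoffelCurvature γ p u v w) = christoffelCurvature γ' (Φ p)
      (fderiv ℝ Φ p u) (fderiv ℝ Φ p v) (fderiv ℝ Φ p w) := by
  have hd : HasFDerivAt Φ (fderiv ℝ Φ p) p := (hΦ.differentiableAt (by simp)).hasFDerivAt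
  have hA := hΦ.hasFDerivAt_fderiv
  have hΦ' : ContDiffAt ℝ ∞ (fderiv ℝ Φ) p := hΦ.fderiv_right (m := ∞) (by simp)
  have hB := hΦ'.hasFDerivAt_fderiv
  have hsymm : ∀ a b, fderiv ℝ (fderiv ℝ Φ) p a b = fderiv ℝ (fderiv ℝ Φ) p b a := fun a b =>
    (hΦ.isSymmSndFDerivAt (by simpa using two_le_infty)) a b
  have hsymm' : ∀ a b, fderiv ℝ (fderiv ℝ (fderiv ℝ Φ)) p a b =
      fderiv ℝ (fderiv ℝ (fderiv ℝ Φ)) p b a := fun a b =>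
    (hΦ'.isSymmSndFDerivAt (by simpa using two_le_infty)) a b
  -- The transformation law of the connection, differentiated in direction `u`. Exchanging `u` and
  -- `v` and subtracting removes the third derivative of `Φ` by symmetry; the Hessian terms are then
  -- eliminated by the law itself.
  have key : ∀ u v w : E,
      fderiv ℝ (fderiv ℝ Φ) p u (γ p v w) + fderiv ℝ Φ p (fderiv ℝ γ p u v w) =
      fderiv ℝ γ' (Φ p) (fderiv ℝ Φ p u) (fderiv ℝ Φ p v) (fderiv ℝ Φ p w)
      + γ' (Φ p) (fderiv ℝ (fderiv ℝ Φ) p u v) (fderiv ℝ Φ p w)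
      + γ' (Φ p) (fderiv ℝ Φ p v) (fderiv ℝ (fderiv ℝ Φ) p u w)
      + fderiv ℝ (fderiv ℝ (fderiv ℝ Φ)) p u v w := by
    intro u v w
    have h1 := hA.clm_apply
      ((hγ.hasFDerivAt.clm_apply (hasFDerivAt_const v p)).clm_apply (hasFDerivAt_const w p))
    have hγΦ : HasFDerivAt (fun q => γ' (Φ q)) ((fderiv ℝ γ' (Φ p)).comp (fderiv ℝ Φ p)) p :=
      HasFDerivAt.comp (g := γ') p hγ'.hasFDerivAt hd
    have h2 := ((hγΦ.clm_apply
      (hA.clm_apply (hasFDerivAt_const v p))).clm_apply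
        (hA.clm_apply (hasFDerivAt_const w p))).add
      ((hB.clm_apply (hasFDerivAt_const v p)).clm_apply (hasFDerivAt_const w p))
    have h3 := h2.congr_of_eventuallyEq (f₁ := fun q => fderiv ℝ Φ q (γ q v w))
      (by filter_upwards [h] with q hq using hq v w)
    have h4 := congrArg (fun L => L u) (h1.unique h3)
    simp at h4
    rw [add_comm, h4]
    abel
  have h0 := h.self_of_nhds
  have k1 := key u v w
  have k2 := key v u w
  rw [hsymm' v u, hsymm v u] at k2
  simp only [christoffelCurvature, map_sub, map_add]
  rw [h0 u (γ p v w), h0 v (γ p u w), h0 v w, h0 u w]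
  simp only [map_add]
  rw [← sub_eq_zero] at k1 k2 ⊢
  rw [← sub_eq_zero.mpr (k1.trans k2.symm)]
  abel

end Naturality

/-! ### Tensors and covariant derivatives evaluated on vectors. -/

section Tensor

variable {ι κ : Type} [Fintype ι] [DecidableEq ι] [Fintype κ] [DecidableEq κ]

omit [DecidableEq ι] in
theorem TensorField.eval_update {r : ℕ} (T : TensorField ι r) (p : ι → ℝ) (v : Fin r → ι → ℝ)
    (s : Fin r) (x : ι → ℝ) : T.eval p (Function.update v s x) =
      ∑ J : Fin r → ι, T p J * (x (J s) * ∏ t ∈ Finset.univ.erase s, v t (J t)) := by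
  unfold TensorField.eval
  refine Finset.sum_congr rfl fun J _ => ?_
  rw [← Finset.mul_prod_erase _ _ (Finset.mem_univ s)]
  congr 2
  · simp
  · exact Finset.prod_congr rfl fun t ht => by
      rw [Function.update_of_ne (Finset.ne_of_mem_erase ht)]

omit [DecidableEq ι] in
theorem TensorField.eval_update_add {r : ℕ} (T : TensorField ι r) (p : ι → ℝ)
    (v : Fin r → ι → ℝ) (s : Fin r) (x y : ι → ℝ) :
    T.eval p (Function.update v s (x + y)) =
      T.eval p (Function.update v s x) + T.eval p (Function.update v s y) := by
  simp only [TensorField.eval_update, ← Finset.sum_add_distrib, Pi.add_apply]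
  exact Finset.sum_congr rfl fun J _ => by ring

-- Product rule in which the base point and all arguments move. The main case has arguments `dΦ_q
-- v_s`, whose derivatives are values of the Hessian of `Φ`.
omit [DecidableEq ι] [DecidableEq κ] in
theorem TensorField.hasFDerivAt_eval {r : ℕ} {T : TensorField κ r} {Φ : (ι → ℝ) → κ → ℝ}
    {Φ' : (ι → ℝ) →L[ℝ] κ → ℝ} {p : ι → ℝ} {X : Fin r → (ι → ℝ) → κ → ℝ}
    {X' : Fin r → (ι → ℝ) →L[ℝ] κ → ℝ}
    (hT : ∀ J, DifferentiableAt ℝ (fun q => T q J) (Φ p)) (hΦ : HasFDerivAt Φ Φ' p)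
    (hX : ∀ s, HasFDerivAt (X s) (X' s) p) (u : ι → ℝ) :
    fderiv ℝ (fun q => T.eval (Φ q) (fun s => X s q)) p u =
      (∑ J, fderiv ℝ (fun q => T q J) (Φ p) (Φ' u) * ∏ s, X s p (J s))
      + ∑ s, T.eval (Φ p) (Function.update (fun s => X s p) s (X' s u)) := by
  have h : HasFDerivAt (fun q => T.eval (Φ q) (fun s => X s q)) (∑ J : Fin r → κ,
      (T (Φ p) J • (∑ s, (∏ t ∈ Finset.univ.erase s, X t p (J t)) •
        (ContinuousLinearMap.proj (R := ℝ) (φ := fun _ : κ => ℝ) (J s)).comp (X' s))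
      + (∏ s, X s p (J s)) • (fderiv ℝ (fun q => T q J) (Φ p)).comp Φ')) p := by
    unfold TensorField.eval
    refine HasFDerivAt.fun_sum fun J _ => ?_
    refine HasFDerivAt.mul ((hT J).hasFDerivAt.comp p hΦ) ?_
    refine HasFDerivAt.finsetProd fun s _ => ?_
    exact (ContinuousLinearMap.proj (R := ℝ) (φ := fun _ : κ => ℝ) (J s)).hasFDerivAt.comp p (hX s)
  rw [h.fderiv]
  simp only [TensorField.eval_update]
  rw [Finset.sum_comm, ← Finset.sum_add_distrib]
  simp only [sum_apply]
  refine Finset.sum_congr rfl fun J _ => ?_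
  simp [Finset.mul_sum]
  rw [add_comm]
  congr 1
  · ring
  · exact Finset.sum_congr rfl fun J _ => by ring

omit [DecidableEq ι] in
theorem sum_snoc {r : ℕ} (f : (Fin (r + 1) → ι) → ℝ) :
    ∑ J, f J = ∑ J : Fin r → ι, ∑ k, f (Fin.snoc J k) := by
  rw [← (Fin.snocEquiv fun _ => ι).sum_comp, Fintype.sum_prod_type, Finset.sum_comm]
  rfl

theorem TensorField.eval_covDeriv {r : ℕ} (Γ : ConnectionCoeffs ι) (T : TensorField ι r)
    (p : ι → ℝ) (v : Fin (r + 1) → ι → ℝ) :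
    (T.covDeriv Γ).eval p v =
      (∑ J, fderiv ℝ (fun q => T q J) p (v (Fin.last r)) * ∏ s, v s.castSucc (J s))
      - ∑ s, T.eval p (Function.update (Fin.init v) s
          (Γ.bilin p (v (Fin.last r)) (Fin.init v s))) := by
  have h2 : ∀ s : Fin r, T.eval p (Function.update (Fin.init v) s
          (Γ.bilin p (v (Fin.last r)) (Fin.init v s))) =
      ∑ J : Fin r → ι, ∑ k, v (Fin.last r) k * (∑ m, Γ p m k (J s) *
        T p (Function.update J s m)) * ∏ t, v t.castSucc (J t) := by
    intro s
    -- In components `Γ` is contracted with an index of `T`; on vectors it produces the argument of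
    -- slot `s`. This involution swaps `J s` with the summation index and so matches the two sums.
    let σ : Equiv.Perm ((Fin r → ι) × ι) := Function.Involutive.toPerm
      (fun x => (Function.update x.1 s x.2, x.1 s)) fun x => by simp
    have hl : ∀ J : Fin r → ι, T p J * (Γ.bilin p (v (Fin.last r)) (Fin.init v s) (J s) *
        ∏ t ∈ Finset.univ.erase s, Fin.init v t (J t)) = ∑ b, ∑ k, T p J *
          (Γ p (J s) k b * v (Fin.last r) k * Fin.init v s b *
            ∏ t ∈ Finset.univ.erase s, Fin.init v t (J t)) := by
      intro J
      rw [ConnectionCoeffs.bilin_apply, Finset.sum_comm]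
      simp only [Finset.sum_mul, Finset.mul_sum]
    have hr : ∀ J : Fin r → ι, ∑ k, v (Fin.last r) k * (∑ m, Γ p m k (J s) *
        T p (Function.update J s m)) * ∏ t, v t.castSucc (J t) = ∑ m, ∑ k,
          T p (Function.update J s m) * (Γ p m k (J s) * v (Fin.last r) k * Fin.init v s (J s) *
            ∏ t ∈ Finset.univ.erase s, Fin.init v t (J t)) := by
      intro J
      rw [Finset.sum_comm]
      refine Finset.sum_congr rfl fun k _ => ?_
      rw [← Finset.mul_prod_erase _ _ (Finset.mem_univ s), Finset.mul_sum, Finset.sum_mul]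
      refine Finset.sum_congr rfl fun m _ => ?_
      simp only [Fin.init]
      ring
    simp only [TensorField.eval_update, hl, hr]
    rw [← Fintype.sum_prod_type' (f := fun (J : Fin r → ι) b => ∑ k, T p J *
        (Γ p (J s) k b * v (Fin.last r) k * Fin.init v s b *
          ∏ t ∈ Finset.univ.erase s, Fin.init v t (J t))),
      ← Fintype.sum_prod_type' (f := fun (J : Fin r → ι) m => ∑ k,
        T p (Function.update J s m) * (Γ p m k (J s) * v (Fin.last r) k * Fin.init v s (J s) *
          ∏ t ∈ Finset.univ.erase s, Fin.init v t (J t))), ← Equiv.sum_comp σ]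
    have hσ : ∀ x, σ x = (Function.update x.1 s x.2, x.1 s) := fun _ => rfl
    refine Finset.sum_congr rfl fun x _ => Finset.sum_congr rfl fun k _ => ?_
    have : ∏ t ∈ Finset.univ.erase s, Fin.init v t (Function.update x.1 s x.2 t) =
        ∏ t ∈ Finset.univ.erase s, Fin.init v t (x.1 t) :=
      Finset.prod_congr rfl fun t ht => by
        rw [Function.update_of_ne (Finset.ne_of_mem_erase ht)]
    simp [hσ, this]
  simp only [h2]
  rw [TensorField.eval, sum_snoc, Finset.sum_comm (s := Finset.univ (α := Fin r)),
    ← Finset.sum_sub_distrib]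
  refine Finset.sum_congr rfl fun J _ => ?_
  rw [Finset.sum_comm, ← sum_mul_partialDeriv, Finset.sum_mul, ← Finset.sum_sub_distrib]
  refine Finset.sum_congr rfl fun k _ => ?_
  simp only [TensorField.covDeriv, Fin.init_snoc, Fin.snoc_last, Fin.prod_univ_castSucc,
    Fin.snoc_castSucc]
  rw [← Finset.sum_mul, ← Finset.mul_sum]
  ring

/-- The covariant derivative evaluated on vectors. -/
theorem TensorField.eval_covDeriv' {r : ℕ} (Γ : ConnectionCoeffs ι) {T : TensorField ι r}
    {p : ι → ℝ} (hT : ∀ J, DifferentiableAt ℝ (fun q => T q J) p) (v : Fin (r + 1) → ι → ℝ) :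
    (T.covDeriv Γ).eval p v = fderiv ℝ (fun q => T.eval q (Fin.init v)) p (v (Fin.last r))
      - ∑ s, T.eval p (Function.update (Fin.init v) s
          (Γ.bilin p (v (Fin.last r)) (Fin.init v s))) := by
  rw [TensorField.eval_covDeriv]
  congr 1
  have h := TensorField.hasFDerivAt_eval (X := fun s _ => Fin.init v s) (X' := 0) hT
    (hasFDerivAt_id p) (fun s => hasFDerivAt_const _ _) (v (Fin.last r))
  simp only [id] at h
  rw [h]
  simp [TensorField.eval_update, Fin.init]

/-- The curvature operator evaluated on vectors. -/
theorem christoffelCurvature_bilin {Γ : ConnectionCoeffs ι} {p : ι → ℝ} {U : Set (ι → ℝ)}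
    (hU : U ∈ 𝓝 p) (hΓ : ∀ l i j, ContDiffOn ℝ ∞ (fun q => Γ q l i j) U) (u v w : ι → ℝ) (l : ι) :
    christoffelCurvature Γ.bilin p u v w l =
      ∑ a, ∑ b, ∑ c, curvatureOperator Γ p l ![a, b, c] * u a * v b * w c := by
  have hd : DifferentiableAt ℝ Γ.bilin p :=
    ((ConnectionCoeffs.contDiffOn_bilin hΓ).contDiffAt hU).differentiableAt (by simp)
  have hΓ' : ∀ l i j, DifferentiableAt ℝ (fun q => Γ q l i j) p := fun l i j =>
    ((hΓ l i j).contDiffAt hU).differentiableAt (by simp)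
  have hD : ∀ u v w : ι → ℝ, fderiv ℝ Γ.bilin p u v w l =
      ∑ i, ∑ j, (∑ k, u k * partialDeriv k (fun q => Γ q l i j) p) * v i * w j := by
    intro u v w
    have h1 := (hasFDerivAt_pi'.1
      ((hd.hasFDerivAt.clm_apply (hasFDerivAt_const v p)).clm_apply (hasFDerivAt_const w p))) l
    have h2 : HasFDerivAt (fun q => Γ.bilin q v w l)
        (∑ i, ∑ j, (v i * w j) • fderiv ℝ (fun q => Γ q l i j) p) p := by
      simp only [ConnectionCoeffs.bilin_apply, mul_assoc]
      exact HasFDerivAt.fun_sum fun i _ => HasFDerivAt.fun_sum fun j _ =>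
        (hΓ' l i j).hasFDerivAt.mul_const _
    have h3 := congrArg (fun L => L u) (h1.unique h2)
    simp at h3
    rw [h3]
    simp only [sum_mul_partialDeriv]
    exact Finset.sum_congr rfl fun i _ => Finset.sum_congr rfl fun j _ => by ring
  have hS : ∀ u v w : ι → ℝ, Γ.bilin p u (Γ.bilin p v w) l =
      ∑ a, ∑ b, ∑ c, (∑ m, Γ p l a m * Γ p m b c) * u a * v b * w c := by
    intro u v w
    rw [ConnectionCoeffs.bilin_apply]
    refine Finset.sum_congr rfl fun a _ => ?_
    simp only [ConnectionCoeffs.bilin_apply, Finset.sum_mul, Finset.mul_sum]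
    rw [Finset.sum_comm]
    refine Finset.sum_congr rfl fun b _ => ?_
    rw [Finset.sum_comm]
    exact Finset.sum_congr rfl fun c _ => Finset.sum_congr rfl fun m _ => by ring
  have e1 : fderiv ℝ Γ.bilin p u v w l = ∑ a, ∑ b, ∑ c,
      partialDeriv a (fun q => Γ q l b c) p * u a * v b * w c := by
    rw [hD]
    simp only [Finset.sum_mul]
    conv_lhs => enter [2, i]; rw [Finset.sum_comm]
    rw [Finset.sum_comm]
    exact Finset.sum_congr rfl fun a _ => Finset.sum_congr rfl fun b _ =>
      Finset.sum_congr rfl fun c _ => by ring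
  have e2 : fderiv ℝ Γ.bilin p v u w l = ∑ a, ∑ b, ∑ c,
      partialDeriv b (fun q => Γ q l a c) p * u a * v b * w c := by
    rw [hD]
    simp only [Finset.sum_mul]
    conv_lhs => enter [2, i]; rw [Finset.sum_comm]
    exact Finset.sum_congr rfl fun a _ => Finset.sum_congr rfl fun b _ =>
      Finset.sum_congr rfl fun c _ => by ring
  have e4 : Γ.bilin p v (Γ.bilin p u w) l =
      ∑ a, ∑ b, ∑ c, (∑ m, Γ p l b m * Γ p m a c) * u a * v b * w c := by
    rw [hS, Finset.sum_comm]
    exact Finset.sum_congr rfl fun a _ => Finset.sum_congr rfl fun b _ =>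
      Finset.sum_congr rfl fun c _ => by ring
  simp only [christoffelCurvature, Pi.add_apply, Pi.sub_apply]
  rw [e1, e2, hS, e4]
  simp only [← Finset.sum_add_distrib, ← Finset.sum_sub_distrib]
  refine Finset.sum_congr rfl fun a _ => Finset.sum_congr rfl fun b _ =>
      Finset.sum_congr rfl fun c _ => ?_
  simp [curvatureOperator, Finset.sum_sub_distrib]
  ring

omit [DecidableEq ι] in
theorem sum_fin_four_fun (f : (Fin 4 → ι) → ℝ) :
    ∑ J, f J = ∑ a, ∑ b, ∑ c, ∑ d, f ![a, b, c, d] := by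
  have h : ∀ {n : ℕ} (f : (Fin (n + 1) → ι) → ℝ),
      ∑ J, f J = ∑ a, ∑ J : Fin n → ι, f (Matrix.vecCons a J) := by
    intro n f
    rw [← (Fin.consEquiv fun _ => ι).sum_comp, Fintype.sum_prod_type]
    rfl
  simp only [h]
  simp only [Finset.univ_unique, Finset.sum_singleton,
    Subsingleton.elim (default : Fin 0 → ι) ![]]

/-- Rewrites `R` through `christoffelCurvature`, to which naturality under smooth maps applies. -/
theorem MetricField.eval_riemann {g : MetricField ι} {U : Set (ι → ℝ)} {p : ι → ℝ}
    (hU : IsOpen U) (hp : p ∈ U) (hg : IsPseudoMetricOn g U) (v : Fin 4 → ι → ℝ) :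
    g.riemann.eval p v =
      g.form p (christoffelCurvature g.leviCivita.bilin p (v 0) (v 1) (v 2)) (v 3) := by
  rw [MetricField.form_apply, MetricField.inner, TensorField.eval, sum_fin_four_fun]
  simp only [christoffelCurvature_bilin (hU.mem_nhds hp) (g.contDiffOn_leviCivita hU hg),
    MetricField.riemann, Fin.prod_univ_four, Finset.sum_mul, Finset.mul_sum]
  symm
  conv_lhs => enter [2, l]; rw [Finset.sum_comm]
  rw [Finset.sum_comm]
  refine Finset.sum_congr rfl fun a _ => ?_
  conv_lhs => enter [2, l]; rw [Finset.sum_comm]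
  rw [Finset.sum_comm]
  refine Finset.sum_congr rfl fun b _ => ?_
  conv_lhs => enter [2, l]; rw [Finset.sum_comm]
  rw [Finset.sum_comm]
  refine Finset.sum_congr rfl fun c _ => ?_
  rw [Finset.sum_comm]
  refine Finset.sum_congr rfl fun d _ => Finset.sum_congr rfl fun l _ => ?_
  simp
  ring

end Tensor

/-! ### Invariance of the connection and of ∇^k R under local isometries. -/

namespace IsLocalIsometry

variable {ι κ : Type} [Fintype ι] [DecidableEq ι] [Fintype κ] [DecidableEq κ]
  {g : MetricField ι} {h : MetricField κ} {Φ : OpenPartialHomeomorph (ι → ℝ) (κ → ℝ)}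

omit [DecidableEq ι] [DecidableEq κ] in
theorem contDiffAt (hΦ : IsLocalIsometry g h Φ) {p : ι → ℝ} (hp : p ∈ Φ.source) :
    ContDiffAt ℝ ∞ Φ p :=
  hΦ.smooth.contDiffAt (Φ.open_source.mem_nhds hp)

omit [DecidableEq ι] [DecidableEq κ] in
theorem fderiv_symm_fderiv (hΦ : IsLocalIsometry g h Φ) {p : ι → ℝ} (hp : p ∈ Φ.source)
    (v : ι → ℝ) : fderiv ℝ Φ.symm (Φ p) (fderiv ℝ Φ p v) = v := by
  have h1 := ((hΦ.contDiffAt hp).differentiableAt (by simp)).hasFDerivAt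
  have h2 : HasFDerivAt Φ.symm (fderiv ℝ Φ.symm (Φ p)) (Φ p) :=
    ((hΦ.smooth_symm.contDiffAt
      (Φ.open_target.mem_nhds (Φ.map_source hp))).differentiableAt (by simp)).hasFDerivAt
  have h3 := (h2.comp p h1).congr_of_eventuallyEq (f₁ := id) (by
    filter_upwards [Φ.open_source.mem_nhds hp] with q hq
    simp [Φ.left_inv hq])
  simpa using congrArg (fun L => L v) (h3.unique (hasFDerivAt_id p))

omit [DecidableEq ι] [DecidableEq κ] in
theorem fderiv_fderiv_symm (hΦ : IsLocalIsometry g h Φ) {p : ι → ℝ} (hp : p ∈ Φ.source)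
    (v : κ → ℝ) : fderiv ℝ Φ p (fderiv ℝ Φ.symm (Φ p) v) = v := by
  have h1 := ((hΦ.contDiffAt hp).differentiableAt (by simp)).hasFDerivAt
  have h2 : HasFDerivAt Φ.symm (fderiv ℝ Φ.symm (Φ p)) (Φ p) :=
    ((hΦ.smooth_symm.contDiffAt
      (Φ.open_target.mem_nhds (Φ.map_source hp))).differentiableAt (by simp)).hasFDerivAt
  rw [← Φ.left_inv hp] at h1
  have h3 := (h1.comp (Φ p) h2).congr_of_eventuallyEq (f₁ := id) (by
    filter_upwards [Φ.open_target.mem_nhds (Φ.map_source hp)] with q hq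
    simp [Φ.right_inv hq])
  rw [Φ.left_inv hp] at h3
  simpa using congrArg (fun L => L v) (h3.unique (hasFDerivAt_id (Φ p)))

/-- The differential of a local isometry as a linear equivalence. -/
def differential (hΦ : IsLocalIsometry g h Φ) {p : ι → ℝ} (hp : p ∈ Φ.source) :
    (ι → ℝ) ≃ₗ[ℝ] (κ → ℝ) :=
  { (fderiv ℝ Φ p : (ι → ℝ) →ₗ[ℝ] (κ → ℝ)) with
    invFun := fderiv ℝ Φ.symm (Φ p)
    left_inv := hΦ.fderiv_symm_fderiv hp
    right_inv := hΦ.fderiv_fderiv_symm hp }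

/-- The transformation law of the Levi-Civita connection. -/
theorem fderiv_leviCivita (hΦ : IsLocalIsometry g h Φ) (hg : IsPseudoMetricOn g Φ.source)
    (hh : IsPseudoMetricOn h Φ.target) {p : ι → ℝ} (hp : p ∈ Φ.source) (v w : ι → ℝ) :
    fderiv ℝ Φ p (g.leviCivita.bilin p v w) =
      h.leviCivita.bilin (Φ p) (fderiv ℝ Φ p v) (fderiv ℝ Φ p w)
        + fderiv ℝ (fderiv ℝ Φ) p v w := by
  have hs : Φ.source ∈ 𝓝 p := Φ.open_source.mem_nhds hp
  have ht : Φ.target ∈ 𝓝 (Φ p) := Φ.open_target.mem_nhds (Φ.map_source hp)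
  have hsymm : ∀ a b, fderiv ℝ (fderiv ℝ Φ) p a b = fderiv ℝ (fderiv ℝ Φ) p b a := fun a b =>
    ((hΦ.contDiffAt hp).isSymmSndFDerivAt (by simpa using two_le_infty)) a b
  have hcomm : ∀ a b, h.form (Φ p) a b = h.form (Φ p) b a := fun a b => by
    simpa only [MetricField.form_apply] using
      MetricField.inner_comm (hh.symm _ (Φ.map_source hp)) a b
  have hiso : ∀ᶠ q in 𝓝 p, ∀ u w, g.form q u w =
      h.form (Φ q) (fderiv ℝ Φ q u) (fderiv ℝ Φ q w) := by
    filter_upwards [hs] with q hq u w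
    simp only [MetricField.form_apply, hΦ.isometry q hq]
  have hD := fderiv_pullback_form
    (((MetricField.contDiffOn_form hg).contDiffAt hs).differentiableAt (by simp))
    (((MetricField.contDiffOn_form hh).contDiffAt ht).differentiableAt (by simp))
    (hΦ.contDiffAt hp) hiso
  rw [← sub_eq_zero]
  -- The equation is tested against an arbitrary vector, written as `dΦ u`. Koszul's formula yields
  -- six Hessian terms of `Φ`: four cancel in pairs, and the other two both equal the pairing of the
  -- Hessian at `(v, w)` with `dΦ u`.
  refine MetricField.eq_zero_of_inner (hh.nondegenerate _ (Φ.map_source hp)) fun x => ?_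
  rw [← hΦ.fderiv_fderiv_symm hp x]
  set u := fderiv ℝ Φ.symm (Φ p) x
  have k1 := MetricField.inner_leviCivita hg hs v w u
  have k2 := MetricField.inner_leviCivita hh ht (fderiv ℝ Φ p v) (fderiv ℝ Φ p w) (fderiv ℝ Φ p u)
  rw [hiso.self_of_nhds, hD, hD, hD, hsymm w v, hsymm u v, hsymm u w,
    hcomm (fderiv ℝ Φ p u) (fderiv ℝ (fderiv ℝ Φ) p v w),
    hcomm (fderiv ℝ Φ p v) (fderiv ℝ (fderiv ℝ Φ) p w u)] at k1
  rw [← MetricField.form_apply]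
  simp only [map_sub, map_add, sub_apply, add_apply]
  rw [k1, k2]
  ring

/-- Local isometries preserve the curvature tensor. -/
theorem eval_riemann (hΦ : IsLocalIsometry g h Φ) (hg : IsPseudoMetricOn g Φ.source)
    (hh : IsPseudoMetricOn h Φ.target) {p : ι → ℝ} (hp : p ∈ Φ.source) (v : Fin 4 → ι → ℝ) :
    h.riemann.eval (Φ p) (fun s => fderiv ℝ Φ p (v s)) = g.riemann.eval p v := by
  have hs : Φ.source ∈ 𝓝 p := Φ.open_source.mem_nhds hp
  have ht : Φ.target ∈ 𝓝 (Φ p) := Φ.open_target.mem_nhds (Φ.map_source hp)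
  rw [MetricField.eval_riemann Φ.open_target (Φ.map_source hp) hh,
    MetricField.eval_riemann Φ.open_source hp hg, ← christoffelCurvature_map
      (((ConnectionCoeffs.contDiffOn_bilin
        (g.contDiffOn_leviCivita Φ.open_source hg)).contDiffAt hs).differentiableAt (by simp))
      (((ConnectionCoeffs.contDiffOn_bilin
        (h.contDiffOn_leviCivita Φ.open_target hh)).contDiffAt ht).differentiableAt (by simp))
      (hΦ.contDiffAt hp)
      (by filter_upwards [hs] with q hq v w using hΦ.fderiv_leviCivita hg hh hq v w)]
  simp only [MetricField.form_apply, hΦ.isometry p hp]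

/-- The covariant derivative commutes with the pull-back along a local isometry. -/
theorem eval_covDeriv (hΦ : IsLocalIsometry g h Φ) (hg : IsPseudoMetricOn g Φ.source)
    (hh : IsPseudoMetricOn h Φ.target) {r : ℕ} {T : TensorField ι r} {T' : TensorField κ r}
    (hT : ∀ J, ContDiffOn ℝ ∞ (fun q => T q J) Φ.source)
    (hT' : ∀ J, ContDiffOn ℝ ∞ (fun q => T' q J) Φ.target)
    (hTT' : ∀ p ∈ Φ.source, ∀ v, T'.eval (Φ p) (fun s => fderiv ℝ Φ p (v s)) = T.eval p v)
    {p : ι → ℝ} (hp : p ∈ Φ.source) (v : Fin (r + 1) → ι → ℝ) :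
    (T'.covDeriv h.leviCivita).eval (Φ p) (fun s => fderiv ℝ Φ p (v s)) =
      (T.covDeriv g.leviCivita).eval p v := by
  have hs : Φ.source ∈ 𝓝 p := Φ.open_source.mem_nhds hp
  have ht : Φ.target ∈ 𝓝 (Φ p) := Φ.open_target.mem_nhds (Φ.map_source hp)
  rw [TensorField.eval_covDeriv' _ fun J => ((hT J).contDiffAt hs).differentiableAt (by simp),
    TensorField.eval_covDeriv]
  have hA := (hΦ.contDiffAt hp).hasFDerivAt_fderiv
  have h1 : (fun q => T.eval q (Fin.init v)) =ᶠ[𝓝 p]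
      fun q => T'.eval (Φ q) (fun s => fderiv ℝ Φ q (Fin.init v s)) := by
    filter_upwards [hs] with q hq using (hTT' q hq _).symm
  rw [h1.fderiv_eq, TensorField.hasFDerivAt_eval
    (fun J => ((hT' J).contDiffAt ht).differentiableAt (by simp))
    ((hΦ.contDiffAt hp).differentiableAt (by simp)).hasFDerivAt
    (fun s => hA.clm_apply (hasFDerivAt_const (Fin.init v s) p)), add_sub_assoc]
  have hsub : ∀ a b c : ℝ, -b = c → a - b = a + c := fun a b c hbc => by rw [← hbc]; ring
  refine hsub _ _ _ ?_
  rw [← Finset.sum_sub_distrib, ← Finset.sum_neg_distrib]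
  refine Finset.sum_congr rfl fun s _ => ?_
  -- By the transformation law the pushed-forward argument is the connection term of `h` plus a
  -- Hessian. That Hessian cancels the one produced by differentiating `dΦ_q v_s`.
  have h2 : (fun t => fderiv ℝ Φ p (Function.update (Fin.init v) s
      (g.leviCivita.bilin p (v (Fin.last r)) (Fin.init v s)) t)) =
      Function.update (fun t => fderiv ℝ Φ p (Fin.init v t)) s
        (h.leviCivita.bilin (Φ p) (fderiv ℝ Φ p (v (Fin.last r))) (fderiv ℝ Φ p (Fin.init v s))
          + fderiv ℝ (fderiv ℝ Φ) p (v (Fin.last r)) (Fin.init v s)) := by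
    rw [← hΦ.fderiv_leviCivita hg hh hp]
    ext1 t
    rcases eq_or_ne t s with rfl | hts
    · simp
    · simp [hts]
  rw [← hTT' p hp, h2, TensorField.eval_update_add]
  simp
  rfl

/-- Local isometries preserve all covariant derivatives of the curvature tensor. -/
theorem eval_nablaRiemann (hΦ : IsLocalIsometry g h Φ) (hg : IsPseudoMetricOn g Φ.source)
    (hh : IsPseudoMetricOn h Φ.target) (k : ℕ) {p : ι → ℝ} (hp : p ∈ Φ.source)
    (v : Fin (4 + k) → ι → ℝ) :
    (h.nablaRiemann k).eval (Φ p) (fun s => fderiv ℝ Φ p (v s)) = (g.nablaRiemann k).eval p v := by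
  induction k generalizing p with
  | zero => exact hΦ.eval_riemann hg hh hp v
  | succ k ih =>
    exact hΦ.eval_covDeriv hg hh (g.contDiffOn_nablaRiemann Φ.open_source hg k)
      (h.contDiffOn_nablaRiemann Φ.open_target hh k) (fun q hq v => ih hq v) hp v

/-- Local isometries give isomorphisms of the curvature models. -/
theorem curvatureModelIso {g h : MetricField ι} {Φ : OpenPartialHomeomorph (ι → ℝ) (ι → ℝ)}
    (hΦ : IsLocalIsometry g h Φ) (hg : IsPseudoMetricOn g Φ.source)
    (hh : IsPseudoMetricOn h Φ.target) (k : ℕ) {p : ι → ℝ} (hp : p ∈ Φ.source) :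
    CurvatureModelIso k g h p (Φ p) :=
  ⟨hΦ.differential hp, fun v w => hΦ.isometry p hp v w,
    fun i _ v => hΦ.eval_nablaRiemann hg hh i hp v⟩

end IsLocalIsometry

/-! ### Product metrics have no mixed curvature. -/

section Product

variable {ι κ : Type} [Fintype ι] [DecidableEq ι] [Fintype κ] [DecidableEq κ]

/-- No regularity is needed: at a point of differentiability the line derivative is zero, and
elsewhere `fderiv` is zero by convention. -/
theorem partialDeriv_eq_zero_of_invariant {F : (ι → ℝ) → ℝ} {i : ι} {p : ι → ℝ}
    (h : ∀ t : ℝ, F (p + t • Pi.single i 1) = F p) : partialDeriv i F p = 0 := by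
  by_cases hF : DifferentiableAt ℝ F p
  · rw [partialDeriv, ← hF.lineDeriv_eq_fderiv, lineDeriv]
    simp [h]
  · simp [partialDeriv, fderiv_zero_of_not_differentiableAt hF]

/-- The domain of the product of metrics on `U₁` and `U₂`. -/
def prodDomain (U₁ : Set (ι → ℝ)) (U₂ : Set (κ → ℝ)) : Set (ι ⊕ κ → ℝ) :=
  {q | (fun i => q (Sum.inl i)) ∈ U₁ ∧ (fun j => q (Sum.inr j)) ∈ U₂}

variable {U₁ : Set (ι → ℝ)} {U₂ : Set (κ → ℝ)} {g₁ : MetricField ι} {g₂ : MetricField κ}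

omit [Fintype ι] [DecidableEq ι] [Fintype κ] [DecidableEq κ] in
theorem isOpen_prodDomain (h₁ : IsOpen U₁) (h₂ : IsOpen U₂) : IsOpen (prodDomain U₁ U₂) :=
  (h₁.preimage (f := fun q : ι ⊕ κ → ℝ => fun i => q (Sum.inl i)) (by fun_prop)).inter
    (h₂.preimage (f := fun q : ι ⊕ κ → ℝ => fun j => q (Sum.inr j)) (by fun_prop))

theorem isPseudoMetricOn_prod (hg₁ : IsPseudoMetricOn g₁ U₁) (hg₂ : IsPseudoMetricOn g₂ U₂) :
    IsPseudoMetricOn (g₁.prod g₂) (prodDomain U₁ U₂) where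
  smooth i j := by
    rcases i with i | i <;> rcases j with j | j
    · exact (hg₁.smooth i j).comp (t := U₁) (f := fun q : ι ⊕ κ → ℝ => fun i => q (Sum.inl i))
        (ContDiff.contDiffOn (by fun_prop)) fun q hq => hq.1
    · exact contDiffOn_const
    · exact contDiffOn_const
    · exact (hg₂.smooth i j).comp (t := U₂) (f := fun q : ι ⊕ κ → ℝ => fun i => q (Sum.inr i))
        (ContDiff.contDiffOn (by fun_prop)) fun q hq => hq.2
  symm q hq := by
    have h1 := hg₁.symm _ hq.1
    have h2 := hg₂.symm _ hq.2
    unfold Matrix.IsSymm at h1 h2 ⊢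
    rw [MetricField.prod, Matrix.fromBlocks_transpose, h1, h2]
    simp
  nondegenerate q hq := by
    rw [MetricField.prod, Matrix.det_fromBlocks_zero₂₁]
    exact mul_ne_zero (hg₁.nondegenerate _ hq.1) (hg₂.nondegenerate _ hq.2)

theorem prod_inv (hg₁ : IsPseudoMetricOn g₁ U₁) (hg₂ : IsPseudoMetricOn g₂ U₂)
    {q : ι ⊕ κ → ℝ} (hq : q ∈ prodDomain U₁ U₂) :
    (g₁.prod g₂ q)⁻¹ = Matrix.fromBlocks (g₁ fun i => q (Sum.inl i))⁻¹ 0 0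
      (g₂ fun j => q (Sum.inr j))⁻¹ := by
  refine Matrix.inv_eq_right_inv ?_
  rw [MetricField.prod, Matrix.fromBlocks_multiply,
    Matrix.mul_nonsing_inv _ (hg₁.nondegenerate _ hq.1).isUnit,
    Matrix.mul_nonsing_inv _ (hg₂.nondegenerate _ hq.2).isUnit]
  simp

theorem partialDeriv_inl_comp {F : (ι → ℝ) → ℝ} {q : ι ⊕ κ → ℝ}
    (hF : DifferentiableAt ℝ F fun i => q (Sum.inl i)) (i : ι) :
    partialDeriv (Sum.inl i) (fun q : ι ⊕ κ → ℝ => F fun i => q (Sum.inl i)) q =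
      partialDeriv i F fun i => q (Sum.inl i) := by
  have h := HasFDerivAt.comp (g := F) q hF.hasFDerivAt
    (f := fun q : ι ⊕ κ → ℝ => fun i => q (Sum.inl i))
    (f' := ContinuousLinearMap.pi fun i => ContinuousLinearMap.proj (Sum.inl i))
    (hasFDerivAt_pi.2 fun i => hasFDerivAt_apply _ _)
  rw [partialDeriv, partialDeriv]
  erw [h.fderiv]
  simp only [ContinuousLinearMap.comp_apply]
  congr 1
  ext j
  simp [Pi.single_apply]

theorem partialDeriv_inr_comp {F : (κ → ℝ) → ℝ} {q : ι ⊕ κ → ℝ}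
    (hF : DifferentiableAt ℝ F fun i => q (Sum.inr i)) (i : κ) :
    partialDeriv (Sum.inr i) (fun q : ι ⊕ κ → ℝ => F fun i => q (Sum.inr i)) q =
      partialDeriv i F fun i => q (Sum.inr i) := by
  have h := HasFDerivAt.comp (g := F) q hF.hasFDerivAt
    (f := fun q : ι ⊕ κ → ℝ => fun i => q (Sum.inr i))
    (f' := ContinuousLinearMap.pi fun i => ContinuousLinearMap.proj (Sum.inr i))
    (hasFDerivAt_pi.2 fun i => hasFDerivAt_apply _ _)
  rw [partialDeriv, partialDeriv]
  erw [h.fderiv]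
  simp only [ContinuousLinearMap.comp_apply]
  congr 1
  ext j
  simp [Pi.single_apply]

theorem partialDeriv_inl_comp_inr (F : (κ → ℝ) → ℝ) (q : ι ⊕ κ → ℝ) (i : ι) :
    partialDeriv (Sum.inl i) (fun q : ι ⊕ κ → ℝ => F fun i => q (Sum.inr i)) q = 0 :=
  partialDeriv_eq_zero_of_invariant fun t => by simp

theorem partialDeriv_inr_comp_inl (F : (ι → ℝ) → ℝ) (q : ι ⊕ κ → ℝ) (i : κ) :
    partialDeriv (Sum.inr i) (fun q : ι ⊕ κ → ℝ => F fun i => q (Sum.inl i)) q = 0 :=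
  partialDeriv_eq_zero_of_invariant fun t => by simp

omit [Fintype ι] in
theorem partialDeriv_const (c : ℝ) (i : ι) (p : ι → ℝ) : partialDeriv i (fun _ => c) p = 0 := by
  simp [partialDeriv]

/-- The product of two connections. -/
def ConnectionCoeffs.prod (Γ₁ : ConnectionCoeffs ι) (Γ₂ : ConnectionCoeffs κ) :
    ConnectionCoeffs (ι ⊕ κ)
  | q, Sum.inl l, Sum.inl i, Sum.inl j => Γ₁ (fun i => q (Sum.inl i)) l i j
  | q, Sum.inr l, Sum.inr i, Sum.inr j => Γ₂ (fun i => q (Sum.inr i)) l i j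
  | _, _, _, _ => 0

theorem leviCivita_prod (h₁ : IsOpen U₁) (h₂ : IsOpen U₂) (hg₁ : IsPseudoMetricOn g₁ U₁)
    (hg₂ : IsPseudoMetricOn g₂ U₂) {q : ι ⊕ κ → ℝ} (hq : q ∈ prodDomain U₁ U₂)
    (l i j : ι ⊕ κ) : (g₁.prod g₂).leviCivita q l i j =
      ConnectionCoeffs.prod g₁.leviCivita g₂.leviCivita q l i j := by
  have hd₁ : ∀ i j, DifferentiableAt ℝ (fun p => g₁ p i j) fun i => q (Sum.inl i) := fun i j =>
    ((hg₁.smooth i j).contDiffAt (h₁.mem_nhds hq.1)).differentiableAt (by simp)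
  have hd₂ : ∀ i j, DifferentiableAt ℝ (fun p => g₂ p i j) fun i => q (Sum.inr i) := fun i j =>
    ((hg₂.smooth i j).contDiffAt (h₂.mem_nhds hq.2)).differentiableAt (by simp)
  have a1 := fun i j k => partialDeriv_inl_comp (hd₁ i j) k
  have a2 := fun i j k => partialDeriv_inr_comp (hd₂ i j) k
  have a3 := fun i j => partialDeriv_inl_comp_inr (ι := ι) (fun p => g₂ p i j) q
  have a4 := fun i j => partialDeriv_inr_comp_inl (κ := κ) (fun p => g₁ p i j) q
  rw [MetricField.leviCivita, prod_inv hg₁ hg₂ hq]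
  rcases l with l | l <;> rcases i with i | i <;> rcases j with j | j <;>
    simp [MetricField.prod, ConnectionCoeffs.prod, MetricField.leviCivita, a1, a2, a3, a4, partialDeriv_const]

theorem leviCivita_prod_eq_zero (h₁ : IsOpen U₁) (h₂ : IsOpen U₂) (hg₁ : IsPseudoMetricOn g₁ U₁)
    (hg₂ : IsPseudoMetricOn g₂ U₂) {q : ι ⊕ κ → ℝ} (hq : q ∈ prodDomain U₁ U₂)
    {l i j : ι ⊕ κ} (h : ¬ (l.isLeft = i.isLeft ∧ i.isLeft = j.isLeft)) :
    (g₁.prod g₂).leviCivita q l i j = 0 := by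
  rw [leviCivita_prod h₁ h₂ hg₁ hg₂ hq]
  rcases l with l | l <;> rcases i with i | i <;> rcases j with j | j <;>
    simp [ConnectionCoeffs.prod] at h ⊢

theorem partialDeriv_leviCivita_prod_eq_zero (h₁ : IsOpen U₁) (h₂ : IsOpen U₂)
    (hg₁ : IsPseudoMetricOn g₁ U₁) (hg₂ : IsPseudoMetricOn g₂ U₂) {q : ι ⊕ κ → ℝ}
    (hq : q ∈ prodDomain U₁ U₂) {k l i j : ι ⊕ κ}
    (h : ¬ (k.isLeft = l.isLeft ∧ l.isLeft = i.isLeft ∧ i.isLeft = j.isLeft)) :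
    partialDeriv k (fun q => (g₁.prod g₂).leviCivita q l i j) q = 0 := by
  -- The block formula has to hold on a neighborhood of `q` before it can be differentiated there.
  have hev : (fun q => (g₁.prod g₂).leviCivita q l i j) =ᶠ[𝓝 q] fun q =>
      ConnectionCoeffs.prod g₁.leviCivita g₂.leviCivita q l i j := by
    filter_upwards [(isOpen_prodDomain h₁ h₂).mem_nhds hq] with p hp
    exact leviCivita_prod h₁ h₂ hg₁ hg₂ hp l i j
  rw [partialDeriv, hev.fderiv_eq, ← partialDeriv]
  rcases k with k | k <;> rcases l with l | l <;> rcases i with i | i <;> rcases j with j | j <;>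
    simp [ConnectionCoeffs.prod, partialDeriv_const] at h ⊢
  · exact partialDeriv_inl_comp_inr (fun p => g₂.leviCivita p l i j) q k
  · exact partialDeriv_inr_comp_inl (fun p => g₁.leviCivita p l i j) q k

/-- The curvature of a product has no mixed components. -/
theorem riemann_prod_eq_zero (h₁ : IsOpen U₁) (h₂ : IsOpen U₂) (hg₁ : IsPseudoMetricOn g₁ U₁)
    (hg₂ : IsPseudoMetricOn g₂ U₂) {q : ι ⊕ κ → ℝ} (hq : q ∈ prodDomain U₁ U₂)
    {J : Fin 4 → ι ⊕ κ} {s t : Fin 4} (hst : (J s).isLeft ≠ (J t).isLeft) :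
    (g₁.prod g₂).riemann q J = 0 := by
  unfold MetricField.riemann
  refine Finset.sum_eq_zero fun l _ => ?_
  -- If `l` and `J 3` lie in different blocks, the metric factor vanishes. Otherwise one of `J 0`,
  -- `J 1`, `J 2` lies in the block opposite to `l`, so every derivative and every product of
  -- Christoffel symbols in the curvature operator mixes the blocks and vanishes.
  by_cases hl : l.isLeft = (J 3).isLeft
  · have hmix : ¬ (l.isLeft = (J 0).isLeft ∧ l.isLeft = (J 1).isLeft
        ∧ l.isLeft = (J 2).isLeft) := by
      rintro ⟨h0, h1, h2⟩
      have hall : ∀ r, (J r).isLeft = l.isLeft := by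
        intro r; fin_cases r
        exacts [h0.symm, h1.symm, h2.symm, hl.symm]
      exact hst ((hall s).trans (hall t).symm)
    have e1 : ∀ a b c m, ¬ (l.isLeft = a.isLeft ∧ l.isLeft = b.isLeft ∧ l.isLeft = c.isLeft) →
        (g₁.prod g₂).leviCivita q l a m * (g₁.prod g₂).leviCivita q m b c = 0 := by
      intro a b c m h
      by_contra hne
      obtain ⟨hne1, hne2⟩ := mul_ne_zero_iff.1 hne
      have k1 := not_imp_comm.1 (leviCivita_prod_eq_zero h₁ h₂ hg₁ hg₂ hq) hne1
      have k2 := not_imp_comm.1 (leviCivita_prod_eq_zero h₁ h₂ hg₁ hg₂ hq) hne2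
      exact h ⟨k1.1, k1.1.trans (k1.2.trans k2.1), k1.1.trans (k1.2.trans (k2.1.trans k2.2))⟩
    have : curvatureOperator (g₁.prod g₂).leviCivita q l ![J 0, J 1, J 2] = 0 := by
      simp only [curvatureOperator, Matrix.cons_val]
      rw [partialDeriv_leviCivita_prod_eq_zero h₁ h₂ hg₁ hg₂ hq,
        partialDeriv_leviCivita_prod_eq_zero h₁ h₂ hg₁ hg₂ hq, Finset.sum_eq_zero]
      · ring
      · intro m _
        rw [e1 _ _ _ _ hmix, e1 _ _ _ _ fun h => hmix ⟨h.2.1, h.1, h.2.2⟩, sub_zero]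
      · exact fun h => hmix ⟨h.2.1, h.1.symm, h.2.1.trans h.2.2⟩
      · exact fun h => hmix ⟨h.1.symm, h.2.1, h.2.1.trans h.2.2⟩
    rw [this, zero_mul]
  · have : g₁.prod g₂ q l (J 3) = 0 := by
      revert hl
      generalize J 3 = j
      rcases l with l | l <;> rcases j with j | j <;> simp [MetricField.prod]
    rw [this, mul_zero]

/-- A metric which splits locally at `P` has a decomposable curvature model at `P`. -/
theorem LocallyDecomposableAt.not_indecomposable {g : MetricField ι}
    (hg : IsPseudoMetricOn g Set.univ) {P : ι → ℝ} (h : LocallyDecomposableAt g P) :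
    ¬ CurvatureModelIndecomposable g P := by
  obtain ⟨m, n, U₁, U₂, g₁, g₂, Φ, h₁, h₂, hg₁, hg₂, htarget, hΦ, hP⟩ := h
  intro hind
  have hg' : IsPseudoMetricOn g Φ.source :=
    ⟨fun i j => (hg.smooth i j).mono (Set.subset_univ _), fun p _ => hg.symm p trivial,
      fun p _ => hg.nondegenerate p trivial⟩
  change Φ.target = prodDomain U₁ U₂ at htarget
  have hh : IsPseudoMetricOn (g₁.prod g₂) Φ.target := by
    rw [htarget]; exact isPseudoMetricOn_prod hg₁ hg₂
  have hQ : Φ P ∈ prodDomain U₁ U₂ := by rw [← htarget]; exact Φ.map_source hP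
  set D := hΦ.differential hP with hD
  -- `V` and `W` are the preimages under `dΦ` of the tangent spaces of the two factors.
  let V : Submodule ℝ (ι → ℝ) :=
    { carrier := {v | ∀ j, D v (Sum.inr j) = 0}
      add_mem' := fun ha hb j => by simp [ha j, hb j]
      zero_mem' := fun j => by simp
      smul_mem' := fun c v hv j => by simp [hv j] }
  let W : Submodule ℝ (ι → ℝ) :=
    { carrier := {v | ∀ j, D v (Sum.inl j) = 0}
      add_mem' := fun ha hb j => by simp [ha j, hb j]
      zero_mem' := fun j => by simp
      smul_mem' := fun c v hv j => by simp [hv j] }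
  have hVW : IsCompl V W := by
    constructor
    · rw [Submodule.disjoint_def]
      intro v hv hw
      apply D.injective
      ext (j | j)
      · simpa using hw j
      · simpa using hv j
    · rw [codisjoint_iff, Submodule.eq_top_iff']
      intro v
      refine Submodule.mem_sup.2 ⟨D.symm (Sum.elim (fun i => D v (Sum.inl i)) 0), ?_,
        D.symm (Sum.elim 0 (fun i => D v (Sum.inr i))), ?_, ?_⟩
      · intro j; simp
      · intro j; simp
      · apply D.injective
        ext (j | j) <;> simp
  have horth : ∀ v ∈ V, ∀ w ∈ W, g.inner P v w = 0 := by
    intro v hv w hw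
    rw [← hΦ.isometry P hP]
    change (g₁.prod g₂).inner (Φ P) (D v) (D w) = 0
    unfold MetricField.inner
    refine Finset.sum_eq_zero fun i _ => Finset.sum_eq_zero fun j _ => ?_
    rcases i with i | i <;> rcases j with j | j
    · simp [hw j]
    · simp [MetricField.prod]
    · simp [hv i]
    · simp [hv i]
  have hmixed : ∀ u : Fin 4 → ι → ℝ, (∀ s, u s ∈ V ∨ u s ∈ W) → (∃ s, u s ∈ V) →
      (∃ s, u s ∈ W) → g.riemann.eval P u = 0 := by
    rintro u - ⟨s, hs⟩ ⟨t, ht⟩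
    rw [← hΦ.eval_riemann hg' hh hP]
    change (g₁.prod g₂).riemann.eval (Φ P) (fun s => D (u s)) = 0
    unfold TensorField.eval
    refine Finset.sum_eq_zero fun J _ => ?_
    by_cases hJ : (J s).isLeft = (J t).isLeft
    · rw [mul_eq_zero]
      right
      cases hJs : J s with
      | inl a =>
        rw [hJs, eq_comm, Sum.isLeft_inl, Sum.isLeft_iff] at hJ
        obtain ⟨b, hb⟩ := hJ
        exact Finset.prod_eq_zero (Finset.mem_univ t) (by rw [hb]; exact ht b)
      | inr a => exact Finset.prod_eq_zero (Finset.mem_univ s) (by rw [hJs]; exact hs a)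
    · rw [riemann_prod_eq_zero h₁ h₂ hg₁ hg₂ hQ hJ, zero_mul]
  -- Both factors have positive dimension, so each block has an index `0`; its coordinate vector
  -- pulls back to a nonzero element of `V` or of `W`.
  rcases hind V W hVW horth hmixed with hbot | hbot
  · have : D.symm (Pi.single (Sum.inl 0) 1) ∈ V := fun j => by simp
    rw [hbot, Submodule.mem_bot, map_eq_zero_iff _ D.symm.injective] at this
    simp at this
  · have : D.symm (Pi.single (Sum.inr 0) 1) ∈ W := fun j => by simp
    rw [hbot, Submodule.mem_bot, map_eq_zero_iff _ D.symm.injective] at this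
    simp at this

end Product

/-! ### Christoffel symbols, curvature and its first two covariant derivatives. -/

section Model

/-- The Christoffel symbols of `metricM f` divided by `f'`. -/
def modelGamma (l i j : Fin 3) : ℝ :=
  if l = 1 ∧ i = 0 ∧ j = 0 then 1
  else if l = 2 ∧ (i = 0 ∧ j = 1 ∨ i = 1 ∧ j = 0) then -1 else 0

/-- The components of the parallel two-form `dx ∧ dy`. -/
def modelForm (i j : Fin 3) : ℝ :=
  if i = 0 ∧ j = 1 then 1 else if i = 1 ∧ j = 0 then -1 else 0

/-- The components of the parallel endomorphism `∂_y ↦ ∂_x̃`, `∂_x ↦ -∂_y`. -/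
def modelEndo (l j : Fin 3) : ℝ :=
  if l = 2 ∧ j = 1 then 1 else if l = 1 ∧ j = 0 then -1 else 0

/-- The components of the one-form `dx^a`. -/
def coordForm (a i : Fin 3) : ℝ := if i = a then 1 else 0

variable {f : ℝ → ℝ}

theorem metricM_inv (f : ℝ → ℝ) (p : Fin 3 → ℝ) :
    (metricM f p)⁻¹ = !![0, 0, 1; 0, 1, 0; 1, 0, 2 * f (p 1)] := by
  refine Matrix.inv_eq_right_inv ?_
  ext i j
  fin_cases i <;> fin_cases j <;> simp [metricM, Matrix.mul_apply, Fin.sum_univ_three]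

theorem partialDeriv_comp_one {F : ℝ → ℝ} (hF : Differentiable ℝ F) (i : Fin 3)
    (p : Fin 3 → ℝ) :
    partialDeriv i (fun q : Fin 3 → ℝ => F (q 1)) p = deriv F (p 1) * coordForm 1 i := by
  have h := HasFDerivAt.comp p (hF (p 1)).hasDerivAt.hasFDerivAt
    (f := fun q : Fin 3 → ℝ => q 1) (hasFDerivAt_apply 1 p)
  rw [partialDeriv]
  erw [h.fderiv]
  simp [coordForm, Pi.single_apply, eq_comm]

theorem partialDeriv_comp_one_mul {F : ℝ → ℝ} (hF : Differentiable ℝ F) (c : ℝ) (i : Fin 3)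
    (p : Fin 3 → ℝ) :
    partialDeriv i (fun q : Fin 3 → ℝ => F (q 1) * c) p = deriv F (p 1) * c * coordForm 1 i := by
  rw [partialDeriv_comp_one (F := fun y => F y * c) (hF.mul_const c)]
  simp

theorem differentiable_iteratedDeriv (hf : ContDiff ℝ ∞ f) (n : ℕ) :
    Differentiable ℝ (iteratedDeriv n f) :=
  hf.differentiable_iteratedDeriv n (WithTop.coe_lt_coe.2 (ENat.natCast_lt_top n))

theorem leviCivita_metricM (hf : ContDiff ℝ ∞ f) (p : Fin 3 → ℝ) (l i j : Fin 3) :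
    (metricM f).leviCivita p l i j = iteratedDeriv 1 f (p 1) * modelGamma l i j := by
  have h0 : ∀ k, partialDeriv k (fun q => metricM f q 0 0) p =
      -2 * iteratedDeriv 1 f (p 1) * coordForm 1 k := by
    intro k
    have := partialDeriv_comp_one_mul (hf.differentiable (by simp)) (-2) k p
    simp only [metricM, Matrix.of_apply, Matrix.cons_val]
    rw [iteratedDeriv_one]
    rw [mul_comm (-2) (deriv f (p 1)), ← this]
    simp only [mul_comm]
  have h1 : ∀ k i j, ¬ (i = 0 ∧ j = 0) → partialDeriv k (fun q => metricM f q i j) p = 0 := by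
    intro k i j hij
    have : (fun q => metricM f q i j) = fun _ => metricM f 0 i j := by
      ext q
      fin_cases i <;> fin_cases j <;> simp [metricM] at hij ⊢
    rw [this, partialDeriv_const]
  rw [MetricField.leviCivita, metricM_inv]
  fin_cases l <;> fin_cases i <;> fin_cases j <;>
    simp [Fin.sum_univ_three, modelGamma, h0, h1, coordForm]

/-- Says that dx ∧ dy is parallel: its components are constant, so only the connection terms enter,
here with the factor -f' removed. -/
theorem sum_modelGamma_modelForm (k i j : Fin 3) :
    ∑ m, modelGamma m k i * modelForm m j + ∑ m, modelGamma m k j * modelForm i m = 0 := by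
  fin_cases k <;> fin_cases i <;> fin_cases j <;>
    simp [modelGamma, modelForm]

/-- Says that the endomorphism E is parallel. -/
theorem sum_modelGamma_modelEndo (l k j : Fin 3) :
    ∑ m, modelGamma l k m * modelEndo m j - ∑ m, modelGamma m k j * modelEndo l m = 0 := by
  fin_cases k <;> fin_cases l <;> fin_cases j <;>
    simp [modelGamma, modelEndo]

/-- Says that ∇dy = -f' dx ⊗ dx. This failure of dy to be parallel is the source of the f' f''' term
in ∇²R. -/
theorem sum_modelGamma_coordForm_one (k i : Fin 3) :
    ∑ m, modelGamma m k i * coordForm 1 m = coordForm 0 k * coordForm 0 i := by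
  fin_cases k <;> fin_cases i <;> simp [modelGamma, coordForm]

/-- The terms quadratic in f' cancel on antisymmetrising in the first two arguments, so only the
derivative of f' survives. -/
theorem curvatureOperator_metricM (hf : ContDiff ℝ ∞ f) (p : Fin 3 → ℝ) (l : Fin 3)
    (J : Fin 3 → Fin 3) : curvatureOperator (metricM f).leviCivita p l J =
      iteratedDeriv 2 f (p 1) * (modelForm (J 0) (J 1) * modelEndo l (J 2)) := by
  have h2 : deriv (iteratedDeriv 1 f) = iteratedDeriv 2 f := (iteratedDeriv_succ).symm
  simp only [curvatureOperator, leviCivita_metricM hf,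
    partialDeriv_comp_one_mul (differentiable_iteratedDeriv hf 1), h2]
  generalize J 0 = a
  generalize J 1 = b
  generalize J 2 = c
  fin_cases l <;> fin_cases a <;> fin_cases b <;> fin_cases c <;>
    simp [modelGamma, modelForm, modelEndo, coordForm]

/-- Lowering the index turns E into -dx ∧ dy, whence the minus sign and the square of the two-form.
-/
theorem riemann_metricM (hf : ContDiff ℝ ∞ f) (p : Fin 3 → ℝ) (J : Fin 4 → Fin 3) :
    (metricM f).riemann p J =
      iteratedDeriv 2 f (p 1) * -(modelForm (J 0) (J 1) * modelForm (J 2) (J 3)) := by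
  have h : ∀ c d, ∑ l, modelEndo l c * metricM f p l d = -modelForm c d := by
    intro c d
    fin_cases c <;> fin_cases d <;> simp [modelForm, modelEndo, metricM]
  simp only [MetricField.riemann, curvatureOperator_metricM hf, Matrix.cons_val, mul_assoc]
  rw [← Finset.mul_sum, ← Finset.mul_sum, h]
  ring

/-- Since dx ∧ dy is parallel, only the coefficient f'', a function of y alone, gets differentiated.
-/
theorem nablaRiemann_one_metricM (hf : ContDiff ℝ ∞ f) (p : Fin 3 → ℝ) (J : Fin 5 → Fin 3) :
    (metricM f).nablaRiemann 1 p J = iteratedDeriv 3 f (p 1) *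
      -(modelForm (J 0) (J 1) * modelForm (J 2) (J 3) * coordForm 1 (J 4)) := by
  have h2 : deriv (iteratedDeriv 2 f) = iteratedDeriv 3 f := (iteratedDeriv_succ).symm
  change TensorField.covDeriv (metricM f).leviCivita (metricM f).riemann p J = _
  have i0 : Fin.init J 0 = J 0 := rfl
  have i1 : Fin.init J 1 = J 1 := rfl
  have i2 : Fin.init J 2 = J 2 := rfl
  have i3 : Fin.init J 3 = J 3 := rfl
  have i4 : J (Fin.last 4) = J 4 := rfl
  simp only [TensorField.covDeriv, leviCivita_metricM hf, riemann_metricM hf, Fin.sum_univ_four,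
    partialDeriv_comp_one_mul (differentiable_iteratedDeriv hf 2), h2, Function.update_apply,
    i0, i1, i2, i3, i4]
  simp [-iteratedDeriv_one]
  have e1 := sum_modelGamma_modelForm (J 4) (J 0) (J 1)
  have e2 := sum_modelGamma_modelForm (J 4) (J 2) (J 3)
  simp only [Fin.sum_univ_three] at e1 e2 ⊢
  linear_combination
    iteratedDeriv 1 f (p 1) * iteratedDeriv 2 f (p 1) * modelForm (J 2) (J 3) * e1 +
    iteratedDeriv 1 f (p 1) * iteratedDeriv 2 f (p 1) * modelForm (J 0) (J 1) * e2

/-- The f'''' term differentiates the coefficient of ∇R; the other term differentiates dy. -/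
theorem nablaRiemann_two_metricM (hf : ContDiff ℝ ∞ f) (p : Fin 3 → ℝ) (J : Fin 6 → Fin 3) :
    (metricM f).nablaRiemann 2 p J = -(modelForm (J 0) (J 1) * modelForm (J 2) (J 3) *
      (iteratedDeriv 4 f (p 1) * (coordForm 1 (J 4) * coordForm 1 (J 5))
        - iteratedDeriv 1 f (p 1) * iteratedDeriv 3 f (p 1) *
          (coordForm 0 (J 4) * coordForm 0 (J 5)))) := by
  have h2 : deriv (iteratedDeriv 3 f) = iteratedDeriv 4 f := (iteratedDeriv_succ).symm
  change TensorField.covDeriv (metricM f).leviCivita ((metricM f).nablaRiemann 1) p J = _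
  have i0 : Fin.init J 0 = J 0 := rfl
  have i1 : Fin.init J 1 = J 1 := rfl
  have i2 : Fin.init J 2 = J 2 := rfl
  have i3 : Fin.init J 3 = J 3 := rfl
  have i4 : Fin.init J 4 = J 4 := rfl
  have i5 : J (Fin.last 5) = J 5 := rfl
  have hsum : ∀ F : Fin (4 + 1) → ℝ, ∑ s, F s = F 0 + F 1 + F 2 + F 3 + F 4 :=
    Fin.sum_univ_five
  rw [TensorField.covDeriv, hsum]
  simp only [leviCivita_metricM hf, nablaRiemann_one_metricM hf,
    partialDeriv_comp_one_mul (differentiable_iteratedDeriv hf 3), h2, Function.update_apply]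
  have e1 := sum_modelGamma_modelForm (J 5) (J 0) (J 1)
  have e2 := sum_modelGamma_modelForm (J 5) (J 2) (J 3)
  have e3 := sum_modelGamma_coordForm_one (J 5) (J 4)
  simp only [i0, i1, i2, i3, i4, i5]
  simp [-iteratedDeriv_one]
  simp only [Fin.sum_univ_three] at e1 e2 e3 ⊢
  linear_combination iteratedDeriv 1 f (p 1) * iteratedDeriv 3 f (p 1) *
    (modelForm (J 2) (J 3) * coordForm 1 (J 4) * e1
      + modelForm (J 0) (J 1) * coordForm 1 (J 4) * e2
      + modelForm (J 0) (J 1) * modelForm (J 2) (J 3) * e3)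

/-- The computation is repeated for ℛ with its index up, since affine isomorphisms need not preserve
the metric. -/
theorem nablaCurvatureOperator_one_metricM (hf : ContDiff ℝ ∞ f) (p : Fin 3 → ℝ) (l : Fin 3)
    (J : Fin 4 → Fin 3) : nablaCurvatureOperator (metricM f).leviCivita 1 p l J =
      iteratedDeriv 3 f (p 1) *
        (modelForm (J 0) (J 1) * modelEndo l (J 2) * coordForm 1 (J 3)) := by
  have h2 : deriv (iteratedDeriv 2 f) = iteratedDeriv 3 f := (iteratedDeriv_succ).symm
  change VectorTensorField.covDeriv (metricM f).leviCivita
    (curvatureOperator (metricM f).leviCivita) p l J = _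
  have i0 : Fin.init J 0 = J 0 := rfl
  have i1 : Fin.init J 1 = J 1 := rfl
  have i2 : Fin.init J 2 = J 2 := rfl
  have i3 : J (Fin.last 3) = J 3 := rfl
  simp only [VectorTensorField.covDeriv, leviCivita_metricM hf, curvatureOperator_metricM hf,
    Fin.sum_univ_three (M := ℝ), partialDeriv_comp_one_mul (differentiable_iteratedDeriv hf 2), h2,
    Function.update_apply, i0, i1, i2, i3]
  simp [-iteratedDeriv_one]
  have e1 := sum_modelGamma_modelForm (J 3) (J 0) (J 1)
  have e2 := sum_modelGamma_modelEndo l (J 3) (J 2)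
  simp only [Fin.sum_univ_three] at e1 e2 ⊢
  linear_combination
    - iteratedDeriv 1 f (p 1) * iteratedDeriv 2 f (p 1) * modelEndo l (J 2) * e1 +
    iteratedDeriv 1 f (p 1) * iteratedDeriv 2 f (p 1) * modelForm (J 0) (J 1) * e2

theorem nablaCurvatureOperator_two_metricM (hf : ContDiff ℝ ∞ f) (p : Fin 3 → ℝ) (l : Fin 3)
    (J : Fin 5 → Fin 3) : nablaCurvatureOperator (metricM f).leviCivita 2 p l J =
      modelForm (J 0) (J 1) * modelEndo l (J 2) *
      (iteratedDeriv 4 f (p 1) * (coordForm 1 (J 3) * coordForm 1 (J 4))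
        - iteratedDeriv 1 f (p 1) * iteratedDeriv 3 f (p 1) *
          (coordForm 0 (J 3) * coordForm 0 (J 4))) := by
  have h2 : deriv (iteratedDeriv 3 f) = iteratedDeriv 4 f := (iteratedDeriv_succ).symm
  change VectorTensorField.covDeriv (metricM f).leviCivita
    (nablaCurvatureOperator (metricM f).leviCivita 1) p l J = _
  have i0 : Fin.init J 0 = J 0 := rfl
  have i1 : Fin.init J 1 = J 1 := rfl
  have i2 : Fin.init J 2 = J 2 := rfl
  have i3 : Fin.init J 3 = J 3 := rfl
  have i4 : J (Fin.last 4) = J 4 := rfl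
  have hsum : ∀ F : Fin (3 + 1) → ℝ, ∑ s, F s = F 0 + F 1 + F 2 + F 3 :=
    Fin.sum_univ_four
  rw [VectorTensorField.covDeriv, hsum]
  simp only [leviCivita_metricM hf, nablaCurvatureOperator_one_metricM hf,
    partialDeriv_comp_one_mul (differentiable_iteratedDeriv hf 3), h2, Function.update_apply]
  have e1 := sum_modelGamma_modelForm (J 4) (J 0) (J 1)
  have e2 := sum_modelGamma_modelEndo l (J 4) (J 2)
  have e3 := sum_modelGamma_coordForm_one (J 4) (J 3)
  simp only [i0, i1, i2, i3, i4]
  simp [-iteratedDeriv_one]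
  simp only [Fin.sum_univ_three] at e1 e2 e3 ⊢
  linear_combination iteratedDeriv 1 f (p 1) * iteratedDeriv 3 f (p 1) *
    (- modelEndo l (J 2) * coordForm 1 (J 3) * e1
      + modelForm (J 0) (J 1) * coordForm 1 (J 3) * e2
      - modelForm (J 0) (J 1) * modelEndo l (J 2) * e3)

/-- The value of `dx ∧ dy` on two vectors. -/
def planeArea (v w : Fin 3 → ℝ) : ℝ := v 0 * w 1 - v 1 * w 0

/-- The endomorphism `∂_y ↦ ∂_x̃`, `∂_x ↦ -∂_y`, `∂_x̃ ↦ 0`. -/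
def planeEndo (v : Fin 3 → ℝ) : Fin 3 → ℝ := ![0, -v 0, v 1]

theorem sum_modelForm (v w : Fin 3 → ℝ) :
    ∑ i, ∑ j, modelForm i j * (v i * w j) = planeArea v w := by
  simp [Fin.sum_univ_three, modelForm, planeArea]
  ring

theorem sum_modelEndo (v : Fin 3 → ℝ) (l : Fin 3) :
    ∑ j, modelEndo l j * v j = planeEndo v l := by
  fin_cases l <;> simp [modelEndo, planeEndo]

theorem sum_coordForm (a : Fin 3) (v : Fin 3 → ℝ) : ∑ j, coordForm a j * v j = v a := by
  simp [coordForm]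

/-- Evaluation of a tensor product splits off its last factor. With the two-index analogue below,
this reduces sums over all multi-indices to sums over one or two indices. -/
theorem sum_tensor_vector {ι : Type} [Fintype ι] {r : ℕ} (S : (Fin r → ι) → ℝ) (b : ι → ℝ)
    (F : (Fin (r + 1) → ι) → ℝ) (hF : ∀ J k, F (Fin.snoc J k) = S J * b k)
    (v : Fin (r + 1) → ι → ℝ) : ∑ J, F J * ∏ s, v s (J s) =
      (∑ J, S J * ∏ s, v s.castSucc (J s)) * ∑ k, b k * v (Fin.last r) k := by
  rw [sum_snoc, Finset.sum_mul]
  refine Finset.sum_congr rfl fun J _ => ?_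
  rw [Finset.mul_sum]
  refine Finset.sum_congr rfl fun k _ => ?_
  simp only [hF, Fin.prod_univ_castSucc, Fin.snoc_castSucc, Fin.snoc_last]
  ring

theorem sum_tensor_form {ι : Type} [Fintype ι] {r : ℕ} (S : (Fin r → ι) → ℝ) (b : ι → ι → ℝ)
    (F : (Fin (r + 2) → ι) → ℝ)
    (hF : ∀ J i j, F (Fin.snoc (Fin.snoc J i : Fin (r + 1) → ι) j) = S J * b i j)
    (v : Fin (r + 2) → ι → ℝ) : ∑ J, F J * ∏ s, v s (J s) =
      (∑ J, S J * ∏ s, v s.castSucc.castSucc (J s)) *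
        ∑ i, ∑ j, b i j * (v (Fin.last r).castSucc i * v (Fin.last (r + 1)) j) := by
  rw [sum_snoc, sum_snoc, Finset.sum_mul]
  refine Finset.sum_congr rfl fun J _ => ?_
  rw [Finset.mul_sum]
  refine Finset.sum_congr rfl fun k _ => ?_
  rw [Finset.mul_sum]
  refine Finset.sum_congr rfl fun k _ => ?_
  simp only [hF, Fin.prod_univ_castSucc, Fin.snoc_castSucc, Fin.snoc_last]
  ring

theorem sum_modelForm_two (v : Fin 2 → Fin 3 → ℝ) :
    ∑ J : Fin 2 → Fin 3, modelForm (J 0) (J 1) * ∏ s, v s (J s) = planeArea (v 0) (v 1) := by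
  rw [sum_tensor_form (r := 0) (fun _ => 1) modelForm _ fun J i j => by simp [Fin.snoc]]
  rw [sum_modelForm]
  simp

theorem sum_modelForm_four (v : Fin 4 → Fin 3 → ℝ) :
    ∑ J : Fin 4 → Fin 3, modelForm (J 0) (J 1) * modelForm (J 2) (J 3) * ∏ s, v s (J s) =
      planeArea (v 0) (v 1) * planeArea (v 2) (v 3) := by
  rw [sum_tensor_form (r := 2) (fun J => modelForm (J 0) (J 1)) modelForm _
    fun J i j => by simp [Fin.snoc]]
  rw [sum_modelForm, sum_modelForm_two fun s => v s.castSucc.castSucc]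
  rfl

end Model

/-! ### Closed formulas for the tensors on vectors. -/

section Evaluation

variable {f : ℝ → ℝ}

theorem eval_riemann_metricM (hf : ContDiff ℝ ∞ f) (p : Fin 3 → ℝ) (v : Fin 4 → Fin 3 → ℝ) :
    (metricM f).riemann.eval p v =
      -(iteratedDeriv 2 f (p 1) * (planeArea (v 0) (v 1) * planeArea (v 2) (v 3))) := by
  rw [← sum_modelForm_four, Finset.mul_sum, ← Finset.sum_neg_distrib]
  exact Finset.sum_congr rfl fun J _ => by rw [riemann_metricM hf]; ring

theorem sum_modelForm_five (v : Fin 5 → Fin 3 → ℝ) :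
    ∑ J : Fin 5 → Fin 3, modelForm (J 0) (J 1) * modelForm (J 2) (J 3) * coordForm 1 (J 4) *
      ∏ s, v s (J s) = planeArea (v 0) (v 1) * planeArea (v 2) (v 3) * v 4 1 := by
  rw [sum_tensor_vector (r := 4) (fun J => modelForm (J 0) (J 1) * modelForm (J 2) (J 3))
    (coordForm 1) _ fun J i => rfl]
  rw [sum_coordForm, sum_modelForm_four fun s => v s.castSucc]
  rfl

theorem eval_nablaRiemann_one_metricM (hf : ContDiff ℝ ∞ f) (p : Fin 3 → ℝ)
    (v : Fin 5 → Fin 3 → ℝ) : TensorField.eval ((metricM f).nablaRiemann 1) p v =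
      -(iteratedDeriv 3 f (p 1) *
        (planeArea (v 0) (v 1) * planeArea (v 2) (v 3) * v 4 1)) := by
  rw [← sum_modelForm_five, Finset.mul_sum, ← Finset.sum_neg_distrib]
  exact Finset.sum_congr rfl fun J _ => by rw [nablaRiemann_one_metricM hf]; ring

theorem sum_coordForm_two (a b : ℝ) (v w : Fin 3 → ℝ) :
    ∑ i, ∑ j, (a * (coordForm 1 i * coordForm 1 j) - b * (coordForm 0 i * coordForm 0 j)) *
      (v i * w j) = a * (v 1 * w 1) - b * (v 0 * w 0) := by
  simp [Fin.sum_univ_three, coordForm]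
  ring

theorem eval_nablaRiemann_two_metricM (hf : ContDiff ℝ ∞ f) (p : Fin 3 → ℝ)
    (v : Fin 6 → Fin 3 → ℝ) : TensorField.eval ((metricM f).nablaRiemann 2) p v =
      -(planeArea (v 0) (v 1) * planeArea (v 2) (v 3) *
        (iteratedDeriv 4 f (p 1) * (v 4 1 * v 5 1)
          - iteratedDeriv 1 f (p 1) * iteratedDeriv 3 f (p 1) * (v 4 0 * v 5 0))) := by
  have h := sum_tensor_form (r := 4) (fun J => modelForm (J 0) (J 1) * modelForm (J 2) (J 3))
    (fun i j => iteratedDeriv 4 f (p 1) * (coordForm 1 i * coordForm 1 j)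
      - iteratedDeriv 1 f (p 1) * iteratedDeriv 3 f (p 1) * (coordForm 0 i * coordForm 0 j))
    (fun J => -(metricM f).nablaRiemann 2 p J)
    (fun J i j => by rw [nablaRiemann_two_metricM hf, neg_neg]; rfl) v
  rw [sum_coordForm_two, sum_modelForm_four fun s => v s.castSucc.castSucc] at h
  simp only [neg_mul, Finset.sum_neg_distrib] at h
  rw [TensorField.eval, ← neg_eq_iff_eq_neg]
  exact h

theorem sum_modelEndo_three (l : Fin 3) (v : Fin 3 → Fin 3 → ℝ) :
    ∑ J : Fin 3 → Fin 3, modelForm (J 0) (J 1) * modelEndo l (J 2) * ∏ s, v s (J s) =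
      planeArea (v 0) (v 1) * planeEndo (v 2) l := by
  rw [sum_tensor_vector (r := 2) (fun J => modelForm (J 0) (J 1)) (modelEndo l) _
    fun J i => by simp [Fin.snoc]]
  rw [sum_modelEndo, sum_modelForm_two fun s => v s.castSucc]
  rfl

theorem eval_nablaCurvatureOperator_zero_metricM (hf : ContDiff ℝ ∞ f) (p : Fin 3 → ℝ)
    (v : Fin 3 → Fin 3 → ℝ) :
    VectorTensorField.eval (nablaCurvatureOperator (metricM f).leviCivita 0) p v =
      (iteratedDeriv 2 f (p 1) * planeArea (v 0) (v 1)) • planeEndo (v 2) := by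
  ext l
  rw [Pi.smul_apply, smul_eq_mul, mul_assoc, ← sum_modelEndo_three, Finset.mul_sum]
  refine Finset.sum_congr rfl fun J _ => ?_
  change curvatureOperator _ _ _ _ * _ = _
  rw [curvatureOperator_metricM hf]
  ring

theorem eval_nablaCurvatureOperator_one_metricM (hf : ContDiff ℝ ∞ f) (p : Fin 3 → ℝ)
    (v : Fin 4 → Fin 3 → ℝ) :
    VectorTensorField.eval (nablaCurvatureOperator (metricM f).leviCivita 1) p v =
      (iteratedDeriv 3 f (p 1) * planeArea (v 0) (v 1) * v 3 1) • planeEndo (v 2) := by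
  ext l
  have h := sum_tensor_vector (r := 3) (fun J => modelForm (J 0) (J 1) * modelEndo l (J 2))
    (fun i => iteratedDeriv 3 f (p 1) * coordForm 1 i)
    (nablaCurvatureOperator (metricM f).leviCivita 1 p l)
    (fun J i => by
      rw [nablaCurvatureOperator_one_metricM hf]
      change _ * (modelForm (J 0) (J 1) * modelEndo l (J 2) * coordForm 1 i) = _
      ring) v
  simp only [mul_assoc (iteratedDeriv 3 f (p 1)), ← Finset.mul_sum] at h
  rw [sum_coordForm, sum_modelEndo_three l fun s => v s.castSucc] at h
  refine h.trans ?_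
  rw [Pi.smul_apply, smul_eq_mul]
  change planeArea (v 0) (v 1) * planeEndo (v 2) l * (_ * v 3 1) = _
  ring

theorem eval_nablaCurvatureOperator_two_metricM (hf : ContDiff ℝ ∞ f) (p : Fin 3 → ℝ)
    (v : Fin 5 → Fin 3 → ℝ) :
    VectorTensorField.eval (nablaCurvatureOperator (metricM f).leviCivita 2) p v =
      (planeArea (v 0) (v 1) * (iteratedDeriv 4 f (p 1) * (v 3 1 * v 4 1)
          - iteratedDeriv 1 f (p 1) * iteratedDeriv 3 f (p 1) * (v 3 0 * v 4 0))) •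
        planeEndo (v 2) := by
  ext l
  have h := sum_tensor_form (r := 3) (fun J => modelForm (J 0) (J 1) * modelEndo l (J 2))
    (fun i j => iteratedDeriv 4 f (p 1) * (coordForm 1 i * coordForm 1 j)
      - iteratedDeriv 1 f (p 1) * iteratedDeriv 3 f (p 1) * (coordForm 0 i * coordForm 0 j))
    (nablaCurvatureOperator (metricM f).leviCivita 2 p l)
    (fun J i j => by rw [nablaCurvatureOperator_two_metricM hf]; rfl) v
  rw [sum_coordForm_two, sum_modelEndo_three l fun s => v s.castSucc.castSucc] at h
  refine h.trans ?_
  rw [Pi.smul_apply, smul_eq_mul]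
  change planeArea (v 0) (v 1) * planeEndo (v 2) l *
    (_ * (v 3 1 * v 4 1) - _ * (v 3 0 * v 4 0)) = _
  ring

theorem inner_metricM (p v w : Fin 3 → ℝ) : (metricM f).inner p v w =
    -2 * f (p 1) * v 0 * w 0 + v 0 * w 2 + v 2 * w 0 + v 1 * w 1 := by
  simp [MetricField.inner, Fin.sum_univ_three, metricM]
  ring

end Evaluation

/-! ### Vanishing of the scalar Weyl invariants. -/

section Weyl

variable {f : ℝ → ℝ}

/-- `∇^k R` depends on `y` only, has no `x̃` component, and each nonzero component has an `x`. -/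
theorem nablaRiemann_metricM_vanishing (hf : ContDiff ℝ ∞ f) (k : ℕ) :
    (∀ p q J, p 1 = q 1 → (metricM f).nablaRiemann k p J = (metricM f).nablaRiemann k q J) ∧
    (∀ p J, (∃ s, J s = 2) → (metricM f).nablaRiemann k p J = 0) ∧
    (∀ p J, (∀ s, J s ≠ 0) → (metricM f).nablaRiemann k p J = 0) := by
  induction k with
  | zero =>
    have h : ∀ p J, (metricM f).nablaRiemann 0 p J = _ := riemann_metricM hf
    refine ⟨fun p q J hpq => by rw [h, h, hpq], fun p J hs => ?_, fun p J hJ => ?_⟩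
    · rw [h]
      obtain ⟨s, hs⟩ := hs
      change Fin 4 at s
      fin_cases s <;> simp at hs <;> simp [hs, modelForm]
    · rw [h]
      simp [modelForm, hJ]
  | succ k ih =>
    obtain ⟨ih1, ih2, ih3⟩ := ih
    have hpartial : ∀ i p q J, p 1 = q 1 →
        partialDeriv i (fun q => (metricM f).nablaRiemann k q J) p =
          partialDeriv i (fun q => (metricM f).nablaRiemann k q J) q := by
      intro i p q J hpq
      -- Components depending only on y are invariant under translation by `q - p`, and so are their
      -- partial derivatives.
      have : (fun x => (metricM f).nablaRiemann k x J) =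
          fun x => (metricM f).nablaRiemann k (x + (q - p)) J := by
        ext x
        exact ih1 _ _ _ (by simp [hpq])
      have h := fderiv_comp_add_right (𝕜 := ℝ) (f := fun x => (metricM f).nablaRiemann k x J)
        (x := p) (q - p)
      rw [← this, add_sub_cancel] at h
      rw [partialDeriv, h, partialDeriv]
    have hexp : ∀ p J, (metricM f).nablaRiemann (k + 1) p J =
      partialDeriv (J (Fin.last (4 + k))) (fun q => (metricM f).nablaRiemann k q (Fin.init J)) p
      - ∑ s : Fin (4 + k), ∑ m, iteratedDeriv 1 f (p 1) *
        modelGamma m (J (Fin.last (4 + k))) (Fin.init J s) *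
          (metricM f).nablaRiemann k p (Function.update (Fin.init J) s m) := by
      intro p J
      simp only [← leviCivita_metricM hf]
      rfl
    refine ⟨fun p q J hpq => ?_, fun p J hs => ?_, fun p J hJ => ?_⟩
    · rw [hexp, hexp, hpartial _ p q _ hpq, hpq]
      simp only [ih1 p q _ hpq]
    · obtain ⟨s, hs⟩ := hs
      rw [hexp]
      -- An x̃ in the derivative slot gives zero: the components depend on y alone, and no
      -- Christoffel symbol has a lower x̃. An x̃ in an older slot persists in every term except
      -- where `Γ` acts on that slot, and there `Γ` vanishes.
      induction s using Fin.lastCases with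
      | last =>
        change J (Fin.last (4 + k)) = 2 at hs
        rw [hs, partialDeriv_eq_zero_of_invariant fun t => ih1 _ _ _ (by simp)]
        simp [modelGamma]
      | cast s =>
        have h1 : (fun q => (metricM f).nablaRiemann k q (Fin.init J)) = fun _ => 0 := by
          ext q
          exact ih2 q _ ⟨s, hs⟩
        rw [h1, partialDeriv_const, Finset.sum_eq_zero, sub_zero]
        intro t _
        refine Finset.sum_eq_zero fun m _ => ?_
        rcases eq_or_ne t s with rfl | hts
        · have : Fin.init J t = 2 := hs
          simp [modelGamma, this]
        · rw [ih2 p _ ⟨s, by rw [Function.update_of_ne hts.symm]; exact hs⟩, mul_zero]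
    · rw [hexp]
      have h1 : (fun q => (metricM f).nablaRiemann k q (Fin.init J)) = fun _ => 0 := by
        ext q
        exact ih3 q _ fun s => hJ _
      rw [h1, partialDeriv_const, Finset.sum_eq_zero, sub_zero]
      intro t _
      refine Finset.sum_eq_zero fun m _ => ?_
      by_cases hm : m = 2
      · rw [ih2 p _ ⟨t, by simp [hm]⟩, mul_zero]
      · simp [modelGamma, hm, hJ]

/-- In a nonzero summand no index is x̃ and some index is x. The partner of that x would have to be
x̃ for the inverse metric entry to be nonzero. -/
theorem weylInvariants_metricM (hf : ContDiff ℝ ∞ f) :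
    ∀ W ∈ (metricM f).weylInvariants, ∀ p, W p = 0 := by
  intro W hW p
  unfold MetricField.weylInvariants at hW
  induction hW using Submodule.span_induction with
  | mem W hW =>
    obtain ⟨m, k, N, e, rfl⟩ := hW
    unfold MetricField.completeContraction
    refine Finset.sum_eq_zero fun J _ => ?_
    by_contra hne
    obtain ⟨hne1, hne2⟩ := mul_ne_zero_iff.1 hne
    rw [Finset.prod_ne_zero_iff] at hne1 hne2
    have h2 : ∀ x, J x ≠ 2 := fun x hx => hne2 x.1 (Finset.mem_univ _)
      ((nablaRiemann_metricM_vanishing hf (k x.1)).2.1 p _ ⟨x.2, hx⟩)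
    have h0 : ∃ x, J x = 0 := by
      by_contra! hall
      exact hne2 0 (Finset.mem_univ _)
        ((nablaRiemann_metricM_vanishing hf (k 0)).2.2 p _ fun s => hall ⟨0, s⟩)
    obtain ⟨x, hx⟩ := h0
    obtain ⟨⟨t, b⟩, rfl⟩ := e.surjective x
    have hinv : ∀ i j : Fin 3, i ≠ 2 → j ≠ 2 → (i = 0 ∨ j = 0) → (metricM f p)⁻¹ i j = 0 := by
      intro i j hi hj hij
      rw [metricM_inv]
      fin_cases i <;> fin_cases j <;> simp at hi hj hij ⊢
    refine hne1 t (Finset.mem_univ _) (hinv _ _ (h2 _) (h2 _) ?_)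
    fin_cases b
    · exact Or.inl hx
    · exact Or.inr hx
  | zero => rfl
  | add W W' _ _ h h' => simp [h, h']
  | smul c W _ h => simp [h]

end Weyl

/-! ### Indecomposability and local symmetry. -/

section Indecomposable

variable {f : ℝ → ℝ}

/-- The hypotheses put `W` into ker(dx ∧ dy), the line of ∂x̃. The `V`-component of ∂x still has
x-coordinate 1, so orthogonality to it kills the remaining coordinate. -/
theorem eq_bot_of_planeArea_eq_zero {P : Fin 3 → ℝ} {V W : Submodule ℝ (Fin 3 → ℝ)}
    (hVW : V ⊔ W = ⊤) (horth : ∀ v ∈ V, ∀ w ∈ W, (metricM f).inner P v w = 0)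
    (h₁ : ∀ v ∈ V, ∀ w ∈ W, planeArea v w = 0) (h₂ : ∀ v ∈ W, ∀ w ∈ W, planeArea v w = 0) :
    W = ⊥ := by
  have hx : ∀ w ∈ W, ∀ x, planeArea x w = 0 := by
    intro w hw x
    obtain ⟨v, hv, u, hu, rfl⟩ := Submodule.mem_sup.1 (hVW ▸ Submodule.mem_top : x ∈ V ⊔ W)
    have e1 := h₁ v hv w hw
    have e2 := h₂ u hu w hw
    simp only [planeArea, Pi.add_apply] at *
    linarith
  have hw1 : ∀ w ∈ W, w 1 = 0 := fun w hw => by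
    simpa [planeArea] using hx w hw (Pi.single 0 1)
  have hw0 : ∀ w ∈ W, w 0 = 0 := fun w hw => by
    simpa [planeArea] using hx w hw (Pi.single 1 1)
  rw [Submodule.eq_bot_iff]
  intro w hw
  obtain ⟨v, hv, u, hu, hvu⟩ := Submodule.mem_sup.1
    (hVW ▸ Submodule.mem_top : (Pi.single 0 1 : Fin 3 → ℝ) ∈ V ⊔ W)
  have e := horth v hv w hw
  have hv0 : v 0 = 1 := by
    have := congrFun hvu 0
    simpa [hw0 u hu] using this
  rw [inner_metricM, hw0 w hw, hw1 w hw, hv0] at e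
  ext i
  fin_cases i
  · exact hw0 w hw
  · exact hw1 w hw
  · simpa using e

/-- With ω = dx ∧ dy, R(v, w, v, w) = 0 gives ω(v, w) = 0, and R(v, v', w, w') = 0 gives ω(v, v')
ω(w, w') = 0. Thus ω vanishes on `V` or on `W`, as well as between them. -/
theorem curvatureModelIndecomposable_metricM (hf : ContDiff ℝ ∞ f) {P : Fin 3 → ℝ}
    (hP : iteratedDeriv 2 f (P 1) ≠ 0) : CurvatureModelIndecomposable (metricM f) P := by
  intro V W hVW horth hmixed
  have hR : ∀ a b c d, ![a, b, c, d] ∈ {u : Fin 4 → Fin 3 → ℝ | (∀ s, u s ∈ V ∨ u s ∈ W) ∧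
      (∃ s, u s ∈ V) ∧ (∃ s, u s ∈ W)} → planeArea a b * planeArea c d = 0 := by
    intro a b c d hu
    have := hmixed _ hu.1 hu.2.1 hu.2.2
    rw [eval_riemann_metricM hf] at this
    simpa [hP] using this
  have h₁ : ∀ v ∈ V, ∀ w ∈ W, planeArea v w = 0 := by
    intro v hv w hw
    refine mul_self_eq_zero.1 (hR v w v w ⟨?_, ⟨0, hv⟩, ⟨1, hw⟩⟩)
    intro s
    fin_cases s <;> simp [hv, hw]
  have h₂ : ∀ v ∈ V, ∀ v' ∈ V, ∀ w ∈ W, ∀ w' ∈ W, planeArea v v' * planeArea w w' = 0 := by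
    intro v hv v' hv' w hw w' hw'
    refine hR v v' w w' ⟨?_, ⟨0, hv⟩, ⟨2, hw⟩⟩
    intro s
    fin_cases s <;> simp [hv, hw, hv', hw']
  by_cases hW : ∀ w ∈ W, ∀ w' ∈ W, planeArea w w' = 0
  · exact Or.inr (eq_bot_of_planeArea_eq_zero hVW.sup_eq_top horth h₁ hW)
  · push Not at hW
    obtain ⟨w, hw, w', hw', hne⟩ := hW
    refine Or.inl (eq_bot_of_planeArea_eq_zero (f := f) (P := P) (V := W)
      (sup_comm V W ▸ hVW.sup_eq_top) ?_ ?_ ?_)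
    · intro w hw v hv
      rw [MetricField.inner_comm ((metricM_isPseudoMetricOn hf).symm P trivial)]
      exact horth v hv w hw
    · intro w hw v hv
      have := h₁ v hv w hw
      simp only [planeArea] at *
      linarith
    · intro v hv v' hv'
      exact (mul_eq_zero.1 (h₂ v hv v' hv' w hw w' hw')).resolve_right hne

theorem locallySymmetric_metricM (hf : ContDiff ℝ ∞ f) (h : ∀ y, iteratedDeriv 3 f y = 0) :
    LocallySymmetric (metricM f) := by
  intro p J
  have := nablaRiemann_one_metricM hf p J
  rw [h, zero_mul] at this
  exact this

theorem contDiff_quadratic (ε : ℝ) : ContDiff ℝ ∞ fun y : ℝ => (1 / 2) * ε * y ^ 2 := by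
  fun_prop

theorem iteratedDeriv_two_quadratic (ε y : ℝ) :
    iteratedDeriv 2 (fun y : ℝ => (1 / 2) * ε * y ^ 2) y = ε := by
  simp
  ring

theorem iteratedDeriv_three_quadratic (ε y : ℝ) :
    iteratedDeriv 3 (fun y : ℝ => (1 / 2) * ε * y ^ 2) y = 0 := by
  rw [iteratedDeriv_succ, funext (iteratedDeriv_two_quadratic ε), deriv_const]

end Indecomposable

/-! ### Explicit isomorphisms of curvature models. -/

section Isomorphisms

variable {f h : ℝ → ℝ}

/-- The linear automorphism `(v₀, v₁, v₂) ↦ (α v₀, β v₁, μ v₀ + γ v₂)`. -/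
def scaleEquiv (α β γ μ : ℝ) (hα : α ≠ 0) (hβ : β ≠ 0) (hγ : γ ≠ 0) :
    (Fin 3 → ℝ) ≃ₗ[ℝ] (Fin 3 → ℝ) where
  toFun v := ![α * v 0, β * v 1, μ * v 0 + γ * v 2]
  invFun v := ![v 0 / α, v 1 / β, (v 2 - μ * (v 0 / α)) / γ]
  map_add' v w := by
    ext i
    fin_cases i <;> simp <;> ring
  map_smul' c v := by
    ext i
    fin_cases i <;> simp <;> ring
  left_inv v := by
    ext i
    fin_cases i <;> simp <;> field_simp
    ring
  right_inv v := by
    ext i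
    fin_cases i <;> simp <;> field_simp
    ring

theorem scaleEquiv_apply {α β γ μ : ℝ} (hα : α ≠ 0) (hβ : β ≠ 0) (hγ : γ ≠ 0)
    (v : Fin 3 → ℝ) :
    scaleEquiv α β γ μ hα hβ hγ v = ![α * v 0, β * v 1, μ * v 0 + γ * v 2] := rfl

theorem planeArea_scaleEquiv {α β γ μ : ℝ} (hα : α ≠ 0) (hβ : β ≠ 0) (hγ : γ ≠ 0)
    (v w : Fin 3 → ℝ) :
    planeArea (scaleEquiv α β γ μ hα hβ hγ v) (scaleEquiv α β γ μ hα hβ hγ w) =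
      α * β * planeArea v w := by
  simp [planeArea, scaleEquiv_apply]
  ring

/-- Scaling x by `l` and x̃ by `l⁻¹` preserves g(∂x, ∂x̃). The shear `μ` corrects g(∂x, ∂x), which
is what `hμ` expresses. -/
theorem inner_scaleEquiv {l μ : ℝ} (hl : l ≠ 0) {P Q : Fin 3 → ℝ}
    (hμ : h (Q 1) * l ^ 2 - l * μ = f (P 1)) (v w : Fin 3 → ℝ) :
    (metricM h).inner Q (scaleEquiv l 1 l⁻¹ μ hl one_ne_zero (inv_ne_zero hl) v)
      (scaleEquiv l 1 l⁻¹ μ hl one_ne_zero (inv_ne_zero hl) w) = (metricM f).inner P v w := by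
  simp only [inner_metricM, scaleEquiv_apply]
  simp
  rw [← hμ]
  field_simp
  ring

/-- The isometry pulls dx ∧ dy back to `l` times itself and fixes dy, so f'' and f''' are compared
with the same factor `l ^ 2`. -/
theorem curvatureModelIso_metricM (hf : ContDiff ℝ ∞ f) (hh : ContDiff ℝ ∞ h) {k : ℕ}
    (hk : k ≤ 1) {P Q : Fin 3 → ℝ} {l : ℝ} (hl : l ≠ 0)
    (h2 : l ^ 2 * iteratedDeriv 2 h (Q 1) = iteratedDeriv 2 f (P 1))
    (h3 : k = 1 → l ^ 2 * iteratedDeriv 3 h (Q 1) = iteratedDeriv 3 f (P 1)) :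
    CurvatureModelIso k (metricM f) (metricM h) P Q := by
  refine ⟨scaleEquiv l 1 l⁻¹ ((h (Q 1) * l ^ 2 - f (P 1)) / l) hl one_ne_zero (inv_ne_zero hl),
    inner_scaleEquiv hl (by field_simp; ring), fun i hi v => ?_⟩
  have hi1 := hi.trans hk
  interval_cases i
  · refine (eval_riemann_metricM hh Q _).trans (Eq.trans ?_ (eval_riemann_metricM hf P v).symm)
    simp only [planeArea_scaleEquiv]
    rw [← h2]
    ring
  · refine (eval_nablaRiemann_one_metricM hh Q _).trans
      (Eq.trans ?_ (eval_nablaRiemann_one_metricM hf P v).symm)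
    simp only [planeArea_scaleEquiv]
    rw [← h3 (le_antisymm hk hi), scaleEquiv_apply]
    simp
    ring

/-- The factor β²/α on x̃ is forced: E must be multiplied by the same ratio β/α on ∂x ↦ -∂y and on
∂y ↦ ∂x̃. -/
theorem planeEndo_scaleEquiv {α β : ℝ} (hα : α ≠ 0) (hβ : β ≠ 0) (hγ : β ^ 2 / α ≠ 0) (c : ℝ)
    (v : Fin 3 → ℝ) : scaleEquiv α β (β ^ 2 / α) 0 hα hβ hγ (c • planeEndo v) =
      (c * (β / α)) • planeEndo (scaleEquiv α β (β ^ 2 / α) 0 hα hβ hγ v) := by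
  ext i
  fin_cases i <;> simp [planeEndo, scaleEquiv_apply] <;> field_simp

/-- The factor αβ of dx ∧ dy and the factor β/α of E combine to α². Each further dy contributes β
and each dx contributes α. -/
theorem affineModelIso_metricM (hf : ContDiff ℝ ∞ f) {k : ℕ} (hk : k ≤ 2) {P Q : Fin 3 → ℝ}
    {α β : ℝ} (hα : α ≠ 0) (hβ : β ≠ 0)
    (h2 : α ^ 2 * iteratedDeriv 2 f (Q 1) = iteratedDeriv 2 f (P 1))
    (h3 : 1 ≤ k → α ^ 2 * β * iteratedDeriv 3 f (Q 1) = iteratedDeriv 3 f (P 1))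
    (h4 : 2 ≤ k → α ^ 2 * β ^ 2 * iteratedDeriv 4 f (Q 1) = iteratedDeriv 4 f (P 1))
    (h13 : 2 ≤ k → α ^ 4 * (iteratedDeriv 1 f (Q 1) * iteratedDeriv 3 f (Q 1)) =
      iteratedDeriv 1 f (P 1) * iteratedDeriv 3 f (P 1)) :
    ∃ φ : (Fin 3 → ℝ) ≃ₗ[ℝ] (Fin 3 → ℝ), ∀ i ≤ k, ∀ v : Fin (3 + i) → Fin 3 → ℝ,
      (nablaCurvatureOperator (metricM f).leviCivita i).eval Q (fun s => φ (v s))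
        = φ ((nablaCurvatureOperator (metricM f).leviCivita i).eval P v) := by
  refine ⟨scaleEquiv α β (β ^ 2 / α) 0 hα hβ (div_ne_zero (pow_ne_zero 2 hβ) hα),
    fun i hi v => ?_⟩
  have hi1 := hi.trans hk
  interval_cases i
  · refine (eval_nablaCurvatureOperator_zero_metricM hf Q _).trans (Eq.trans ?_
      (congrArg _ (eval_nablaCurvatureOperator_zero_metricM hf P v).symm))
    rw [planeEndo_scaleEquiv, planeArea_scaleEquiv, ← h2]
    congr 1
    field_simp
  · refine (eval_nablaCurvatureOperator_one_metricM hf Q _).trans (Eq.trans ?_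
      (congrArg _ (eval_nablaCurvatureOperator_one_metricM hf P v).symm))
    rw [planeEndo_scaleEquiv, planeArea_scaleEquiv, ← h3 hi, scaleEquiv_apply _ _ _ (v 3)]
    congr 1
    simp
    field_simp
  · refine (eval_nablaCurvatureOperator_two_metricM hf Q _).trans (Eq.trans ?_
      (congrArg _ (eval_nablaCurvatureOperator_two_metricM hf P v).symm))
    rw [planeEndo_scaleEquiv, planeArea_scaleEquiv, ← h4 hi, ← h13 hi,
      scaleEquiv_apply _ _ _ (v 3), scaleEquiv_apply _ _ _ (v 4)]
    congr 1
    simp only [Matrix.cons_val]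
    field_simp

end Isomorphisms

/-! ### Ordinary differential equations for exponentials. -/

section Analysis

theorem mul_pos_of_continuous_of_ne_zero {u : ℝ → ℝ} (hu : Continuous u) (h : ∀ y, u y ≠ 0)
    (s t : ℝ) : 0 < u s * u t := by
  by_contra hst
  have hlt : u s * u t < 0 := lt_of_le_of_ne (not_lt.1 hst) (mul_ne_zero (h s) (h t))
  have : (0 : ℝ) ∈ Set.range u := by
    rcases mul_neg_iff.1 hlt with ⟨h1, h2⟩ | ⟨h1, h2⟩
    · exact mem_range_of_exists_le_of_exists_ge hu ⟨t, h2.le⟩ ⟨s, h1.le⟩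
    · exact mem_range_of_exists_le_of_exists_ge hu ⟨s, h1.le⟩ ⟨t, h2.le⟩
  obtain ⟨y, hy⟩ := this
  exact h y hy

theorem eq_exp_of_deriv_eq_mul {u : ℝ → ℝ} (hu : Differentiable ℝ u) {b : ℝ}
    (h : ∀ y, deriv u y = b * u y) (y : ℝ) : u y = u 0 * Real.exp (b * y) := by
  have hd : ∀ y, HasDerivAt (fun y => u y * Real.exp (-(b * y))) 0 y := by
    intro y
    have h1 : HasDerivAt (fun y => Real.exp (-(b * y))) (Real.exp (-(b * y)) * -(b * 1)) y :=
      (((hasDerivAt_id y).const_mul b).neg).exp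
    have h2 := (hu y).hasDerivAt.mul h1
    refine h2.congr_deriv ?_
    rw [h y]
    ring
  have hc := is_const_of_deriv_eq_zero (fun y => (hd y).differentiableAt)
    (fun y => (hd y).deriv) y 0
  simp only [mul_zero, neg_zero, Real.exp_zero, mul_one] at hc
  rw [← hc, mul_assoc, ← Real.exp_add]
  simp

/-- A function `u` with `u', u'' ≠ 0` for which `u u'' / u'²` is constant is exponential. -/
theorem exists_exp_of_mul_deriv_deriv {u u' u'' : ℝ → ℝ} (hu : ∀ y, HasDerivAt u (u' y) y)
    (hu' : ∀ y, HasDerivAt u' (u'' y) y) (h1 : ∀ y, u' y ≠ 0) (h2 : ∀ y, u'' y ≠ 0)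
    (h : ∀ s t, u s * u'' s * u' t ^ 2 = u t * u'' t * u' s ^ 2) :
    ∃ a b : ℝ, ∀ y, u y = a * Real.exp (b * y) := by
  obtain ⟨k, hk⟩ : ∃ k, ∀ y, u y * u'' y = k * u' y ^ 2 := by
    refine ⟨u 0 * u'' 0 / u' 0 ^ 2, fun y => ?_⟩
    have := h1 0
    field_simp
    linear_combination h y 0
  have hk0 : k ≠ 0 := by
    -- If `k = 0`, then `u'' ≠ 0` makes `u` vanish identically, contradicting `u' ≠ 0`.
    rintro rfl
    have hz : ∀ y, u y = 0 := fun y => by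
      have := hk y
      rw [zero_mul, mul_eq_zero] at this
      exact this.resolve_right (h2 y)
    refine h1 0 ((hu 0).unique ?_)
    rw [funext hz]
    exact hasDerivAt_const _ _
  have hnz : ∀ y, u y ≠ 0 := fun y hy => by
    have := hk y
    rw [hy, zero_mul, eq_comm, mul_eq_zero] at this
    exact this.elim hk0 (pow_ne_zero 2 (h1 y))
  -- The derivative of u/u' is 1 - u u''/u'² = 1 - k, so u/u' is a polynomial of degree at most one
  -- in y.
  have hd : ∀ y, HasDerivAt (fun y => u y / u' y - (1 - k) * y) 0 y := by
    intro y
    have e := ((hu y).div (hu' y) (h1 y)).sub ((hasDerivAt_id y).const_mul (1 - k))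
    refine e.congr_deriv ?_
    have := h1 y
    field_simp
    linear_combination -hk y
  have hc : ∀ y, u y / u' y - (1 - k) * y = u 0 / u' 0 := fun y => by
    have := is_const_of_deriv_eq_zero (fun y => (hd y).differentiableAt)
      (fun y => (hd y).deriv) y 0
    simpa using this
  have hk1 : k = 1 := by
    by_contra hne
    have hne' : 1 - k ≠ 0 := sub_ne_zero.2 (Ne.symm hne)
    -- The point is the zero that u/u' would have if its slope 1 - k were nonzero; but `u` has no
    -- zeros.
    have := hc (-(u 0 / u' 0) / (1 - k))
    rw [mul_div_cancel₀ _ hne'] at this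
    have hz : u (-(u 0 / u' 0) / (1 - k)) / u' (-(u 0 / u' 0) / (1 - k)) = 0 := by linarith
    exact (div_ne_zero (hnz _) (h1 _)) hz
  refine ⟨u 0, u' 0 / u 0, fun y =>
    eq_exp_of_deriv_eq_mul (fun y => (hu y).differentiableAt) (fun y => ?_) y⟩
  have e := hc y
  rw [hk1, sub_self, zero_mul, sub_zero] at e
  have := hnz 0
  have := h1 0
  have := h1 y
  rw [(hu y).deriv]
  field_simp at e ⊢
  linarith

theorem hasDerivAt_iteratedDeriv {f : ℝ → ℝ} (hf : ContDiff ℝ ∞ f) (n : ℕ) (y : ℝ) :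
    HasDerivAt (iteratedDeriv n f) (iteratedDeriv (n + 1) f y) y := by
  rw [iteratedDeriv_succ]
  exact (differentiable_iteratedDeriv hf n y).hasDerivAt

theorem iteratedDeriv_succ_of_eq_exp {f : ℝ → ℝ} {n : ℕ} {a b : ℝ}
    (h : ∀ y, iteratedDeriv n f y = a * Real.exp (b * y)) (y : ℝ) :
    iteratedDeriv (n + 1) f y = (a * b) * Real.exp (b * y) := by
  rw [iteratedDeriv_succ, funext h]
  have : HasDerivAt (fun y => a * Real.exp (b * y)) (a * (Real.exp (b * y) * (b * 1))) y :=
    (((hasDerivAt_id y).const_mul b).exp).const_mul a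
  rw [this.deriv]
  ring

end Analysis

/-! ### Invariants extracted from curvature homogeneity. -/

section Rigidity

variable {f : ℝ → ℝ}

theorem single_zero_one_planeArea : planeArea (Pi.single 0 1) (Pi.single 1 1) = 1 := by
  simp [planeArea]

/-- The form of an isomorphism of `0`-curvature models on the span of `∂_x`, `∂_y`. -/
theorem curvatureModel_rigid (hf : ContDiff ℝ ∞ f) {P Q : Fin 3 → ℝ}
    (hP : iteratedDeriv 2 f (P 1) ≠ 0) (φ : (Fin 3 → ℝ) ≃ₗ[ℝ] (Fin 3 → ℝ))
    (hφ : ∀ v w, (metricM f).inner Q (φ v) (φ w) = (metricM f).inner P v w)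
    (hR : ∀ v : Fin 4 → Fin 3 → ℝ,
      (metricM f).riemann.eval Q (fun s => φ (v s)) = (metricM f).riemann.eval P v) :
    φ (Pi.single 1 1) 0 = 0 ∧ φ (Pi.single 1 1) 1 ^ 2 = 1 ∧
      planeArea (φ (Pi.single 0 1)) (φ (Pi.single 1 1)) ^ 2 = φ (Pi.single 0 1) 0 ^ 2 ∧
      φ (Pi.single 0 1) 0 ^ 2 * iteratedDeriv 2 f (Q 1) = iteratedDeriv 2 f (P 1) := by
  have hR' : ∀ a b c d : Fin 3 → ℝ, iteratedDeriv 2 f (Q 1) *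
      (planeArea (φ a) (φ b) * planeArea (φ c) (φ d)) =
      iteratedDeriv 2 f (P 1) * (planeArea a b * planeArea c d) := by
    intro a b c d
    have := hR ![a, b, c, d]
    rw [eval_riemann_metricM hf, eval_riemann_metricM hf] at this
    simpa using this
  have hD := hR' (Pi.single 0 1) (Pi.single 1 1) (Pi.single 0 1) (Pi.single 1 1)
  rw [single_zero_one_planeArea] at hD
  have hQ : iteratedDeriv 2 f (Q 1) ≠ 0 := fun h => hP (by rw [h] at hD; linarith)
  have hD0 : planeArea (φ (Pi.single 0 1)) (φ (Pi.single 1 1)) ≠ 0 :=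
    fun h => hP (by rw [h] at hD; linarith)
  -- ∂x̃ spans the kernel of R, so its image again lies in ker(dx ∧ dy), the line of ∂x̃.
  -- Orthogonality of ∂y to ∂x̃ then removes the x-component of the image of ∂y.
  have hz : ∀ x, planeArea (φ (Pi.single 2 1)) x = 0 := by
    intro x
    have := hR' (Pi.single 2 1) (φ.symm x) (Pi.single 0 1) (Pi.single 1 1)
    rw [LinearEquiv.apply_symm_apply] at this
    have h0 : planeArea (Pi.single 2 1) (φ.symm x) = 0 := by simp [planeArea]
    rw [h0, zero_mul, mul_zero] at this
    exact (mul_eq_zero.1 ((mul_eq_zero.1 this).resolve_left hQ)).resolve_right hD0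
  have hz0 : φ (Pi.single 2 1) 0 = 0 := by
    simpa [planeArea] using hz (Pi.single 1 1)
  have hz1 : φ (Pi.single 2 1) 1 = 0 := by
    simpa [planeArea] using hz (Pi.single 0 1)
  have hz2 : φ (Pi.single 2 1) 2 ≠ 0 := by
    intro h
    have : φ (Pi.single 2 1) = 0 := by
      ext i
      fin_cases i <;> assumption
    rw [map_eq_zero_iff _ φ.injective] at this
    simp at this
  have hy0 : φ (Pi.single 1 1) 0 = 0 := by
    have := hφ (Pi.single 1 1) (Pi.single 2 1)
    simpa [inner_metricM, hz0, hz1, hz2] using this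
  have hy1 : φ (Pi.single 1 1) 1 ^ 2 = 1 := by
    have := hφ (Pi.single 1 1) (Pi.single 1 1)
    simp [inner_metricM, hy0] at this
    rw [sq, this]
  have hDx : planeArea (φ (Pi.single 0 1)) (φ (Pi.single 1 1)) ^ 2 = φ (Pi.single 0 1) 0 ^ 2 := by
    rw [planeArea, hy0, mul_zero, sub_zero, mul_pow, hy1, mul_one]
  refine ⟨hy0, hy1, hDx, ?_⟩
  rw [← hDx]
  linarith

/-- With λ the x-component of φ(∂x), R gives λ² f''(t) = f''(s), and ∇R on (∂x, ∂y, ∂x, ∂y; ∂y)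
gives ±λ² f'''(t) = f'''(s). The sign is the y-component of φ(∂y); squaring removes it. -/
theorem CurvatureHomogeneous.sq_third_deriv (hf : ContDiff ℝ ∞ f)
    (h2 : ∀ y, iteratedDeriv 2 f y ≠ 0) (h : CurvatureHomogeneous 1 (metricM f)) (s t : ℝ) :
    (iteratedDeriv 3 f s * iteratedDeriv 2 f t) ^ 2 =
      (iteratedDeriv 3 f t * iteratedDeriv 2 f s) ^ 2 := by
  obtain ⟨φ, hφ, hR⟩ := h (fun _ => s) (fun _ => t)
  obtain ⟨-, hy1, hD, h2'⟩ := curvatureModel_rigid hf (h2 s) φ hφ (hR 0 (by norm_num))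
  have h3 := hR 1 le_rfl ![Pi.single 0 1, Pi.single 1 1, Pi.single 0 1, Pi.single 1 1,
    Pi.single 1 1]
  have h3' := ((eval_nablaRiemann_one_metricM hf (fun _ => t) _).symm.trans h3).trans
    (eval_nablaRiemann_one_metricM hf (fun _ => s) _)
  simp [single_zero_one_planeArea] at h3'
  rw [← sq, hD] at h3'
  rw [← h3', ← h2', mul_pow, mul_pow, mul_pow, mul_pow, hy1]
  ring

/-- ∇R with ∂x in the derivative slot forces φ(∂x) to have no y-component. Then ∇²R with ∂x in both
derivative slots scales f' f''' by λ⁴, while R scales f'' by λ², where λ is the x-component of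
φ(∂x). -/
theorem CurvatureHomogeneous.first_mul_third_deriv (hf : ContDiff ℝ ∞ f)
    (h2 : ∀ y, iteratedDeriv 2 f y ≠ 0) (h3 : ∀ y, iteratedDeriv 3 f y ≠ 0)
    (h : CurvatureHomogeneous 2 (metricM f)) (s t : ℝ) :
    iteratedDeriv 1 f s * iteratedDeriv 3 f s * iteratedDeriv 2 f t ^ 2 =
      iteratedDeriv 1 f t * iteratedDeriv 3 f t * iteratedDeriv 2 f s ^ 2 := by
  obtain ⟨φ, hφ, hR⟩ := h (fun _ => s) (fun _ => t)
  obtain ⟨-, -, hD, h2'⟩ := curvatureModel_rigid hf (h2 s) φ hφ (hR 0 (by norm_num))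
  have hx0 : φ (Pi.single 0 1) 0 ≠ 0 := by
    intro h0
    rw [h0] at h2'
    exact h2 s (by rw [← h2']; ring)
  have h3' := ((eval_nablaRiemann_one_metricM hf (fun _ => t) _).symm.trans
    (hR 1 (by norm_num) ![Pi.single 0 1, Pi.single 1 1, Pi.single 0 1, Pi.single 1 1,
      Pi.single 0 1])).trans (eval_nablaRiemann_one_metricM hf (fun _ => s) _)
  simp only [Matrix.cons_val] at h3'
  rw [← sq, hD] at h3'
  have hx1 : φ (Pi.single 0 1) 1 = 0 := by
    simpa [h3 t, hx0] using h3'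
  have h4' := ((eval_nablaRiemann_two_metricM hf (fun _ => t) _).symm.trans
    (hR 2 le_rfl ![Pi.single 0 1, Pi.single 1 1, Pi.single 0 1, Pi.single 1 1,
      Pi.single 0 1, Pi.single 0 1])).trans (eval_nablaRiemann_two_metricM hf (fun _ => s) _)
  simp only [Matrix.cons_val, single_zero_one_planeArea, hx1] at h4'
  rw [← sq, hD] at h4'
  simp [-iteratedDeriv_one] at h4'
  rw [← h4', ← h2']
  ring

/-- No metric is available, but ℛ(∂x, ∂y) sends ∂x to -f'' ∂y and ∂y to f'' ∂x̃. This forces `φ` to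
be triangular enough that λ² and λ⁴ appear as in the isometric case, after cancelling the
y-component of φ(∂y). -/
theorem AffineCurvatureHomogeneous.first_mul_third_deriv (hf : ContDiff ℝ ∞ f)
    (h2 : ∀ y, iteratedDeriv 2 f y ≠ 0) (h3 : ∀ y, iteratedDeriv 3 f y ≠ 0)
    (h : AffineCurvatureHomogeneous 2 (metricM f).leviCivita) (s t : ℝ) :
    iteratedDeriv 1 f s * iteratedDeriv 3 f s * iteratedDeriv 2 f t ^ 2 =
      iteratedDeriv 1 f t * iteratedDeriv 3 f t * iteratedDeriv 2 f s ^ 2 := by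
  obtain ⟨φ, hR⟩ := h (fun _ => s) (fun _ => t)
  have k0 : planeEndo (Pi.single 0 1) = -Pi.single 1 1 := by
    ext i; fin_cases i <;> simp [planeEndo]
  have k1 : planeEndo (Pi.single 1 1) = Pi.single 2 1 := by
    ext i; fin_cases i <;> simp [planeEndo]
  have r0 := fun c => ((eval_nablaCurvatureOperator_zero_metricM hf (fun _ => t) _).symm.trans
    (hR 0 (by norm_num) ![Pi.single 0 1, Pi.single 1 1, c])).trans
      (congrArg φ (eval_nablaCurvatureOperator_zero_metricM hf (fun _ => s) _))
  have r1 := fun c d => ((eval_nablaCurvatureOperator_one_metricM hf (fun _ => t) _).symm.trans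
    (hR 1 (by norm_num) ![Pi.single 0 1, Pi.single 1 1, c, d])).trans
      (congrArg φ (eval_nablaCurvatureOperator_one_metricM hf (fun _ => s) _))
  have r2 := fun c d e =>
    ((eval_nablaCurvatureOperator_two_metricM hf (fun _ => t) _).symm.trans
    (hR 2 le_rfl ![Pi.single 0 1, Pi.single 1 1, c, d, e])).trans
      (congrArg φ (eval_nablaCurvatureOperator_two_metricM hf (fun _ => s) _))
  simp only [Matrix.cons_val, single_zero_one_planeArea, map_smul] at r0 r1 r2
  have a0 := r0 (Pi.single 0 1)
  have a1 := r0 (Pi.single 1 1)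
  have b := r1 (Pi.single 0 1) (Pi.single 0 1)
  have c := r2 (Pi.single 0 1) (Pi.single 0 1) (Pi.single 0 1)
  rw [k0, map_neg] at a0 b c
  rw [k1] at a1
  set x := φ (Pi.single 0 1)
  set y := φ (Pi.single 1 1)
  set z := φ (Pi.single 2 1) with hz
  have hy0 : y 0 = 0 := by
    simpa [planeEndo, h2] using congrFun a0 0
  have hz0 : z 0 = 0 := by
    simpa [planeEndo, h2, eq_comm] using congrFun a1 0
  have hz1 : z 1 = 0 := by
    simpa [planeEndo, h2, eq_comm, hy0] using congrFun a1 1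
  have hz2 : z 2 ≠ 0 := by
    intro h
    have hz' : z = 0 := by
      ext i
      fin_cases i <;> assumption
    rw [hz, map_eq_zero_iff _ φ.injective] at hz'
    simp at hz'
  have hD : planeArea x y = x 0 * y 1 := by rw [planeArea, hy0]; ring
  rw [hD] at a0 a1 b c
  have hxy : x 0 ≠ 0 ∧ y 1 ≠ 0 := by
    rw [← mul_ne_zero_iff]
    intro h0
    have := congrFun a1 2
    simp [h0, h2, hz2] at this
  obtain ⟨hx0, hy1⟩ := hxy
  have e0 : x 0 ^ 2 * iteratedDeriv 2 f t = iteratedDeriv 2 f s := by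
    have := congrFun a0 1
    simp [planeEndo] at this
    refine mul_left_cancel₀ hy1 ?_
    linear_combination this
  have hx1 : x 1 = 0 := by
    have := congrFun b 1
    simpa [planeEndo, h3, hx0, hy1] using this
  have e2 : x 0 ^ 4 * (iteratedDeriv 1 f t * iteratedDeriv 3 f t) =
      iteratedDeriv 1 f s * iteratedDeriv 3 f s := by
    have := congrFun c 1
    simp [planeEndo, hx1, -iteratedDeriv_one] at this
    refine mul_left_cancel₀ hy1 ?_
    linear_combination this
  rw [← e0, ← e2]
  ring

end Rigidity

/-! ### Isometries for exponential f'. -/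

section Homogeneous

variable {f : ℝ → ℝ}

/-- The affine map `p ↦ L (p - P) + Q` as a global chart. -/
def affineChart (L : (Fin 3 → ℝ) ≃ₗ[ℝ] (Fin 3 → ℝ)) (P Q : Fin 3 → ℝ) :
    OpenPartialHomeomorph (Fin 3 → ℝ) (Fin 3 → ℝ) :=
  ((Homeomorph.subRight P).trans
    (L.toContinuousLinearEquiv.toHomeomorph.trans (Homeomorph.addRight Q))).toOpenPartialHomeomorph

theorem affineChart_apply (L : (Fin 3 → ℝ) ≃ₗ[ℝ] (Fin 3 → ℝ)) (P Q p : Fin 3 → ℝ) :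
    affineChart L P Q p = L.toContinuousLinearEquiv (p - P) + Q := rfl

theorem affineChart_symm_apply (L : (Fin 3 → ℝ) ≃ₗ[ℝ] (Fin 3 → ℝ)) (P Q p : Fin 3 → ℝ) :
    (affineChart L P Q).symm p = L.toContinuousLinearEquiv.symm (p - Q) + P := by
  rw [sub_eq_add_neg]
  rfl

theorem fderiv_affineChart (L : (Fin 3 → ℝ) ≃ₗ[ℝ] (Fin 3 → ℝ)) (P Q p v : Fin 3 → ℝ) :
    fderiv ℝ (affineChart L P Q) p v = L v := by
  have h : HasFDerivAt (affineChart L P Q)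
      (L.toContinuousLinearEquiv : (Fin 3 → ℝ) →L[ℝ] (Fin 3 → ℝ)) p := by
    have := ((L.toContinuousLinearEquiv : (Fin 3 → ℝ) →L[ℝ] (Fin 3 → ℝ)).hasFDerivAt.comp p
      ((hasFDerivAt_id p).sub_const P)).add_const Q
    exact this.congr_fderiv (by ext; simp)
  rw [h.fderiv]
  rfl

/-- Here f = (a/b) e^{by} + c. A shift of y by s multiplies the exponential by e^{bs}, which scaling
x by e^{-bs/2} undoes. -/
theorem locallyHomogeneous_of_exp (hf : ContDiff ℝ ∞ f) {a b : ℝ} (hb : b ≠ 0)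
    (h : ∀ y, deriv f y = a * Real.exp (b * y)) : LocallyHomogeneous (metricM f) := by
  obtain ⟨c, hc⟩ : ∃ c, ∀ y, f y = a / b * Real.exp (b * y) + c := by
    refine ⟨f 0 - a / b, fun y => ?_⟩
    have hd : ∀ y, HasDerivAt (fun y => f y - a / b * Real.exp (b * y)) 0 y := by
      intro y
      have h1 : HasDerivAt (fun y => a / b * Real.exp (b * y))
          (a / b * (Real.exp (b * y) * (b * 1))) y :=
        (((hasDerivAt_id y).const_mul b).exp).const_mul _
      have h2 := ((hf.differentiable (by simp)) y).hasDerivAt.sub h1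
      refine h2.congr_deriv ?_
      rw [h y]
      field_simp
      ring
    have := is_const_of_deriv_eq_zero (fun y => (hd y).differentiableAt)
      (fun y => (hd y).deriv) y 0
    simp only [mul_zero, Real.exp_zero, mul_one] at this
    linarith
  intro P Q
  set s := Q 1 - P 1 with hs
  set l := Real.exp (-(b * s) / 2) with hl
  have hl0 : l ≠ 0 := Real.exp_ne_zero _
  have hl2 : l ^ 2 * Real.exp (b * s) = 1 := by
    rw [hl, sq, ← Real.exp_add, ← Real.exp_add, Real.exp_eq_one_iff]
    ring
  -- The shear absorbs the constant c, which is not rescaled by the shift: c l² - l · c (l - l⁻¹) =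
  -- c.
  set L := scaleEquiv l 1 l⁻¹ (c * (l - l⁻¹)) hl0 one_ne_zero (inv_ne_zero hl0) with hL
  refine ⟨affineChart L P Q, ⟨?_, ?_, ?_⟩, trivial, ?_⟩
  · simp only [funext (affineChart_apply L P Q)]
    exact ContDiff.contDiffOn (by fun_prop)
  · simp only [funext (affineChart_symm_apply L P Q)]
    exact ContDiff.contDiffOn (by fun_prop)
  · intro p _ v w
    rw [fderiv_affineChart, fderiv_affineChart]
    refine inner_scaleEquiv hl0 ?_ v w
    have h1 : affineChart L P Q p 1 = p 1 + s := by
      rw [affineChart_apply]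
      change L (p - P) 1 + Q 1 = _
      rw [hL, scaleEquiv_apply]
      simp [hs]
      ring
    rw [h1, hc, hc, mul_add, Real.exp_add]
    field_simp
    linear_combination a * Real.exp (b * p 1) * hl2
  · rw [affineChart_apply]
    simp

end Homogeneous

end

/-! ### Assembly of the assertions. -/

theorem theorem1p2 (f : ℝ → ℝ) (hf : ContDiff ℝ ∞ f) :
    -- all scalar Weyl invariants vanish
    (∀ W ∈ (metricM f).weylInvariants, ∀ p, W p = 0) ∧
    -- the spaces S_ε are indecomposable local symmetric spaces
    (∀ ε : ℝ, ε = 1 ∨ ε = -1 →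
      LocallySymmetric (metricS ε) ∧
      (∀ P, CurvatureModelIndecomposable (metricS ε) P) ∧
      (∀ P, ¬ LocallyDecomposableAt (metricS ε) P)) ∧
    -- 0-curvature modeled on S_ε with ε the (constant) sign of f''
    ((∀ y, iteratedDeriv 2 f y ≠ 0) →
      ∃ ε : ℝ, (ε = 1 ∨ ε = -1) ∧ (∀ y, Real.sign (iteratedDeriv 2 f y) = ε) ∧
        CurvatureModeledOn 0 (metricM f) (metricS ε)) ∧
    ((∀ y, iteratedDeriv 2 f y ≠ 0) → (∀ y, iteratedDeriv 3 f y ≠ 0) →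
      AffineCurvatureHomogeneous 1 (metricM f).leviCivita ∧
      (CurvatureHomogeneous 1 (metricM f) ↔
        ∃ a b : ℝ, ∀ y, iteratedDeriv 2 f y = a * Real.exp (b * y)) ∧
      List.TFAE [
        LocallyHomogeneous (metricM f),
        ∀ k, CurvatureHomogeneous k (metricM f),
        CurvatureHomogeneous 2 (metricM f),
        AffineCurvatureHomogeneous 2 (metricM f).leviCivita,
        ∃ a b : ℝ, ∀ y, deriv f y = a * Real.exp (b * y)]) := by
  have hsq : ∀ {u : ℝ → ℝ}, Continuous u → (∀ y, u y ≠ 0) → ∀ s t, ∃ l : ℝ, l ≠ 0 ∧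
      l ^ 2 * u t = u s := by
    intro u hu h s t
    have hpos : 0 < u s / u t := by
      rw [← mul_div_mul_right _ _ (h t)]
      exact div_pos (mul_pos_of_continuous_of_ne_zero hu h s t) (mul_self_pos.2 (h t))
    refine ⟨√(u s / u t), (Real.sqrt_pos.2 hpos).ne', ?_⟩
    rw [Real.sq_sqrt hpos.le, div_mul_cancel₀ _ (h t)]
  have hcont : ∀ n, Continuous (iteratedDeriv n f) := fun n =>
    (differentiable_iteratedDeriv hf n).continuous
  refine ⟨weylInvariants_metricM hf, fun ε hε => ?_, fun h2 => ?_, fun h2 h3 => ⟨?_, ?_, ?_⟩⟩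
  · have hε0 : ε ≠ 0 := by rcases hε with rfl | rfl <;> norm_num
    have hq := contDiff_quadratic ε
    have hind : ∀ P, CurvatureModelIndecomposable (metricS ε) P := fun P =>
      curvatureModelIndecomposable_metricM hq (by rw [iteratedDeriv_two_quadratic]; exact hε0)
    exact ⟨locallySymmetric_metricM hq (iteratedDeriv_three_quadratic ε), hind,
      fun P hP => hP.not_indecomposable (metricM_isPseudoMetricOn hq) (hind P)⟩
  · have hsign : ∀ y, Real.sign (iteratedDeriv 2 f y) = Real.sign (iteratedDeriv 2 f 0) := by
      intro y
      have := mul_pos_of_continuous_of_ne_zero (hcont 2) h2 y 0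
      rcases mul_pos_iff.1 this with ⟨ha, hb⟩ | ⟨ha, hb⟩
      · rw [Real.sign_of_pos ha, Real.sign_of_pos hb]
      · rw [Real.sign_of_neg ha, Real.sign_of_neg hb]
    refine ⟨Real.sign (iteratedDeriv 2 f 0), (Real.sign_apply_eq_of_ne_zero _ (h2 0)).symm,
      hsign, fun P Q => ?_⟩
    have hpos := abs_pos.2 (h2 (P 1))
    -- On the model the second derivative is the constant ε, so l² = |f''(P)| makes l² ε = f''(P).
    refine curvatureModelIso_metricM hf (contDiff_quadratic _) (by norm_num)
      (l := √|iteratedDeriv 2 f (P 1)|) (Real.sqrt_pos.2 hpos).ne' ?_ (by norm_num)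
    rw [iteratedDeriv_two_quadratic, Real.sq_sqrt hpos.le, ← hsign (P 1)]
    rcases lt_or_gt_of_ne (h2 (P 1)) with h | h
    · rw [abs_of_neg h, Real.sign_of_neg h]
      ring
    · rw [abs_of_pos h, Real.sign_of_pos h, mul_one]
  · intro P Q
    obtain ⟨α, hα, hα2⟩ := hsq (hcont 2) h2 (P 1) (Q 1)
    -- `β` solves α² β f'''(Q) = f'''(P), given α² = f''(P)/f''(Q).
    refine affineModelIso_metricM hf (k := 1) (by norm_num) hα
      (β := iteratedDeriv 3 f (P 1) * iteratedDeriv 2 f (Q 1) /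
        (iteratedDeriv 3 f (Q 1) * iteratedDeriv 2 f (P 1)))
      (div_ne_zero (mul_ne_zero (h3 _) (h2 _)) (mul_ne_zero (h3 _) (h2 _))) hα2 ?_
      (by norm_num) (by norm_num)
    intro _
    have := h3 (Q 1)
    have := h2 (P 1)
    field_simp
    linear_combination iteratedDeriv 3 f (P 1) * hα2
  · constructor
    · intro h
      have hne : ∀ y, iteratedDeriv 3 f y / iteratedDeriv 2 f y ≠ 0 := fun y =>
        div_ne_zero (h3 y) (h2 y)
      have hpos := mul_pos_of_continuous_of_ne_zero ((hcont 3).div (hcont 2) h2) hne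
      refine ⟨_, iteratedDeriv 3 f 0 / iteratedDeriv 2 f 0,
        eq_exp_of_deriv_eq_mul (differentiable_iteratedDeriv hf 2) fun y => ?_⟩
      rw [← iteratedDeriv_succ, ← div_eq_iff (h2 y)]
      have hs : (iteratedDeriv 3 f y / iteratedDeriv 2 f y) ^ 2 =
          (iteratedDeriv 3 f 0 / iteratedDeriv 2 f 0) ^ 2 := by
        have := h.sq_third_deriv hf h2 y 0
        rw [div_pow, div_pow, div_eq_div_iff (pow_ne_zero 2 (h2 _)) (pow_ne_zero 2 (h2 _)),
          ← mul_pow, ← mul_pow]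
        exact this
      -- The square of f'''/f'' is constant, and its sign is constant by continuity. So f''' = b f''
      -- with b its value at 0.
      rcases sq_eq_sq_iff_eq_or_eq_neg.1 hs with h | h
      · exact h
      · have := hpos y 0
        rw [Pi.div_apply, Pi.div_apply, h] at this
        nlinarith [mul_self_nonneg (iteratedDeriv 3 f 0 / iteratedDeriv 2 f 0)]
    · rintro ⟨a, b, hab⟩ P Q
      obtain ⟨l, hl, hl2⟩ := hsq (hcont 2) h2 (P 1) (Q 1)
      refine curvatureModelIso_metricM hf hf le_rfl hl hl2 fun _ => ?_
      have h3' := iteratedDeriv_succ_of_eq_exp hab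
      rw [hab, hab] at hl2
      rw [h3', h3']
      linear_combination b * hl2
  · have hexp : (∀ s t, iteratedDeriv 1 f s * iteratedDeriv 3 f s * iteratedDeriv 2 f t ^ 2 =
        iteratedDeriv 1 f t * iteratedDeriv 3 f t * iteratedDeriv 2 f s ^ 2) →
        ∃ a b : ℝ, ∀ y, deriv f y = a * Real.exp (b * y) := by
      intro h
      rw [← iteratedDeriv_one]
      exact exists_exp_of_mul_deriv_deriv (hasDerivAt_iteratedDeriv hf 1)
        (hasDerivAt_iteratedDeriv hf 2) h2 h3 h
    tfae_have 1 → 2 := by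
      intro h k P Q
      obtain ⟨Φ, hΦ, hP, rfl⟩ := h P Q
      have hm := metricM_isPseudoMetricOn hf
      exact hΦ.curvatureModelIso
        ⟨fun i j => (hm.smooth i j).mono (Set.subset_univ _), fun p _ => hm.symm p trivial,
          fun p _ => hm.nondegenerate p trivial⟩
        ⟨fun i j => (hm.smooth i j).mono (Set.subset_univ _), fun p _ => hm.symm p trivial,
          fun p _ => hm.nondegenerate p trivial⟩ k hP
    tfae_have 2 → 3 := fun h => h 2
    tfae_have 3 → 5 := fun h => hexp (h.first_mul_third_deriv hf h2 h3)
    tfae_have 4 → 5 := fun h => hexp (h.first_mul_third_deriv hf h2 h3)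
    tfae_have 5 → 1 := by
      rintro ⟨a, b, hab⟩
      refine locallyHomogeneous_of_exp hf (b := b) ?_ hab
      -- If b = 0, then f' is constant and f'' vanishes.
      rintro rfl
      have := iteratedDeriv_succ_of_eq_exp (f := f) (n := 1) (a := a) (b := 0) (by simpa using hab) 0
      exact h2 0 (by simpa using this)
    tfae_have 5 → 4 := by
      rintro ⟨a, b, hab⟩ P Q
      rw [← iteratedDeriv_one] at hab
      have d2 := iteratedDeriv_succ_of_eq_exp hab
      have d3 := iteratedDeriv_succ_of_eq_exp d2
      have d4 := iteratedDeriv_succ_of_eq_exp d3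
      obtain ⟨α, hα, hα2⟩ := hsq (hcont 2) h2 (P 1) (Q 1)
      -- No rescaling of y is needed: f'', f''' and f'''' are all constant multiples of e^{by}.
      refine affineModelIso_metricM hf le_rfl hα one_ne_zero hα2 ?_ ?_ ?_
      all_goals
        intro _
        rw [d2, d2] at hα2
      · rw [d3, d3]
        linear_combination b * hα2
      · rw [d4, d4]
        linear_combination b ^ 2 * hα2
      · rw [hab, hab, d3, d3]
        -- The product f' f''' equals (f'')² here, so the identity is `hα2` squared, factored as a
        -- difference of squares.
        linear_combination (α ^ 2 * (a * b * Real.exp (b * Q 1))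
          + a * b * Real.exp (b * P 1)) * hα2
    tfae_finish
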